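/- For a simple graph $G$ write $P_2(G)$ for the sum of the squares of its vertex degrees. Let $v\ge 1$ and $0\le e\le\binom v2$ be integers and put $e'=\binom v2-e$. Let $\mathcal G(v,e)$ be the set of simple graphs with $v$ vertices and $e$ edges; $G\in\mathcal G(v,e)$ is *optimal* if $P_2(G)\ge P_2(H)$ for all $H\in\mathcal G(v,e)$. Let $$\mathrm{Dis}(v,e)=\Big\{\pi=(a_0,a_1,\dots,a_p): v>a_0>a_1>\dots>a_p>0,\ \sum_s a_s=e\Big\}$$ (the empty partition is allowed when $e=0$). For $\pi\in\mathrm{Dis}(v,e)$ the threshold graph $\mathrm{Th}(\pi)\in\mathcal G(v,e)$ has vertices $0,\dots,v-1$, where for $a<b$ the vertices $a,b$ are adjacent if and only if $a\le p$ and $b\le a+a_a$. The partition $\pi$ is *optimal* in $\mathrm{Dis}(v,e)$ if $\mathrm{Th}(\pi)$ is optimal in $\mathcal G(v,e)$. The *diagonal sequence* of $\pi$ is $(\delta_t)_t$, where $\delta_t$ is the number of edges $\{a,b\}$ of $\mathrm{Th}(\pi)$ with $a+b=t$. There are unique integers $k,j$ with $e=\binom{k+1}2-j$, $1\le j\le k$,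 and unique integers $k',j'$ with $e=\binom v2-\binom{k'+1}2+j'$, $1\le j'\le k'$. The *quasi-complete graph* $\mathrm{QC}(v,e)$ consists of a complete graph on $k$ of the $v$ vertices together with, if $j<k$, one further vertex adjacent to exactly $k-j$ of these $k$ vertices; all other vertices are isolated. The *quasi-star graph* $\mathrm{QS}(v,e)$ is the complement of $\mathrm{QC}(v,e')$. Put $C(v,e)=P_2(\mathrm{QC}(v,e))$ and $S(v,e)=P_2(\mathrm{QS}(v,e))$. **Theorem.** Every optimal partition in $\mathrm{Dis}(v,e)$ is one of the following six partitions, where a hat marks an omitted part: 1. $\pi_{1.1}=(v-1,v-2,\dots,k'+1,j')$ (to be read as the empty partition if $k'=v$, in which case $e=0$); 2. $\pi_{1.2}=(v-1,v-2,\dots,\widehat{2k'-j'-1},\dots,k'-1)$, if $k'+1\le 2k'-j'-1\le v-1$; 3. $\pi_{1.3}=(v-1,v-2,\dots,k'+1,2,1)$, if $j'=3$ and $v\ge 4$; 4. $\pi_{2.1}=(k,k-1,\dots,\widehat{j},\dots,2,1)$; 5. $\pi_{2.2}=(2k-j-1,k-2,k-3,\dots,2,1)$, if $k+1\le 2k-j-1\le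 v-1$; 6. $\pi_{2.3}=(k,k-1,\dots,3)$, if $j=3$ and $v\ge 4$. Conversely, each of these, whenever its stated condition holds, is a partition in $\mathrm{Dis}(v,e)$; in particular $\pi_{1.1}$ and $\pi_{2.1}$ always exist. Moreover $\mathrm{Th}(\pi_{1.1})\cong\mathrm{QS}(v,e)$ and $\mathrm{Th}(\pi_{2.1})\cong\mathrm{QC}(v,e)$, and at least one of $\pi_{1.1},\pi_{2.1}$ is optimal. Furthermore, $\pi_{1.2}$ and $\pi_{1.3}$, when their conditions hold, have the same diagonal sequence as $\pi_{1.1}$, and if $S(v,e)\ge C(v,e)$, then $\pi_{1.1}$ and those of $\pi_{1.2},\pi_{1.3}$ whose conditions hold are all optimal. Similarly, $\pi_{2.2}$ and $\pi_{2.3}$, when their conditions hold, have the same diagonal sequence as $\pi_{2.1}$, and if $S(v,e)\le C(v,e)$, then $\pi_{2.1}$ and those of $\pi_{2.2},\pi_{2.3}$ whose conditions hold are all optimal. -/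

import Mathlib

/-- `𝒢(v, e)`: the simple graphs with vertex set `{0, …, v - 1}` and exactly `e` edges. -/
def graphClass (v e : ℕ) : Set (SimpleGraph (Fin v)) :=
  {G | G.edgeSet.ncard = e}

open Classical in
/-- `P₂(G)`: the sum of the squares of the degrees of `G`. -/
noncomputable def P2 {v : ℕ} (G : SimpleGraph (Fin v)) : ℕ :=
  ∑ i, G.degree i ^ 2

/-- `G` is optimal in `𝒢(v, e)`: it maximises `P₂` among all graphs with `v` vertices and
`e` edges. -/
def IsOptimalGraph (v e : ℕ) (G : SimpleGraph (Fin v)) : Prop :=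
  G ∈ graphClass v e ∧ ∀ H ∈ graphClass v e, P2 H ≤ P2 G

/-- The quasi-complete graph `QC(v, e)`. Write `e = (k+1 choose 2) - j` with `1 ≤ j ≤ k` (such
`k`, `j` exist and are unique); the graph consists of the complete graph on the vertices
`0, …, k - 1` and of the edges joining the vertex `k` to the vertices `0, …, k - j - 1`. -/
def quasiComplete (v e : ℕ) : SimpleGraph (Fin v) :=
  SimpleGraph.fromRel fun a b =>
    ∃ k j : ℕ, 1 ≤ j ∧ j ≤ k ∧ e + j = (k + 1).choose 2 ∧
      ((a.val < k ∧ b.val < k) ∨ (a.val < k - j ∧ b.val = k))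

/-- The quasi-star graph `QS(v, e)`: the complement of `QC(v, e')`, `e' = (v choose 2) - e`. -/
def quasiStar (v e : ℕ) : SimpleGraph (Fin v) :=
  (quasiComplete v (v.choose 2 - e))ᶜ

/-- `C(v, e)`: the sum of the squared degrees of the quasi-complete graph. -/
noncomputable def qcSum (v e : ℕ) : ℕ := P2 (quasiComplete v e)

/-- `S(v, e)`: the sum of the squared degrees of the quasi-star graph. -/
noncomputable def qsSum (v e : ℕ) : ℕ := P2 (quasiStar v e)

/-- `Dis(v, e)`: the partitions of `e` into distinct positive parts smaller than `v`; a partition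
into distinct parts is given by its finite set of parts. -/
def Dis (v e : ℕ) : Set (Finset ℕ) :=
  {π | (∀ a ∈ π, 0 < a ∧ a < v) ∧ ∑ a ∈ π, a = e}

/-- The part `a_s` of `π = (a_0 > a_1 > ⋯ > a_p)`, and `0` if `s > p`. -/
def part (π : Finset ℕ) (s : ℕ) : ℕ :=
  (π.sort (· ≥ ·)).getD s 0

/-- The threshold graph `Th(π)` on `v` vertices: the part above the diagonal of its adjacency
matrix (rows and columns numbered from `0`) is left-justified and has `a_s` ones in row `s`, namely
in the columns `s + 1, …, s + a_s`. -/
def Th (v : ℕ) (π : Finset ℕ) : SimpleGraph (Fin v) :=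
  SimpleGraph.fromRel fun a b => a.val < b.val ∧ b.val ≤ a.val + part π a.val

/-- The diagonal sequence of `Th(π)`: `δ_t` is the number of ones above the main diagonal of the
adjacency matrix on the `t`-th anti-diagonal, which consists of the positions `(a, b)` with
`a + b = t` (rows and columns numbered from `0`). The sequence is extended by zeros. -/
noncomputable def diagSeq (v : ℕ) (π : Finset ℕ) (t : ℕ) : ℕ :=
  {p : Fin v × Fin v | p.1 < p.2 ∧ (Th v π).Adj p.1 p.2 ∧ p.1.val + p.2.val = t}.ncard

/-- `π` is optimal in `Dis(v, e)`. -/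
def IsOptimal (v e : ℕ) (π : Finset ℕ) : Prop :=
  π ∈ Dis v e ∧ IsOptimalGraph v e (Th v π)

/-- `π` is the quasi-star partition in `Dis(v, e)`: its threshold graph is `QS(v, e)`. -/
def IsQuasiStarPartition (v e : ℕ) (π : Finset ℕ) : Prop :=
  π ∈ Dis v e ∧ Nonempty (Th v π ≃g quasiStar v e)

/-- `π` is the quasi-complete partition in `Dis(v, e)`: its threshold graph is `QC(v, e)`. -/
def IsQuasiCompletePartition (v e : ℕ) (π : Finset ℕ) : Prop :=
  π ∈ Dis v e ∧ Nonempty (Th v π ≃g quasiComplete v e)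

/-- `(v-1, v-2, …, k'+1, j')`, understood as the empty partition when `k' = v`. -/
def pi11 (v k' j' : ℕ) : Finset ℕ :=
  if k' = v then ∅ else insert j' (Finset.Icc (k' + 1) (v - 1))

/-- `(v-1, v-2, …, k'-1)` with the part `2k'-j'-1` left out. -/
def pi12 (v k' j' : ℕ) : Finset ℕ :=
  (Finset.Icc (k' - 1) (v - 1)).erase (2 * k' - j' - 1)

/-- `(v-1, v-2, …, k'+1, 2, 1)`. -/
def pi13 (v k' : ℕ) : Finset ℕ :=
  Finset.Icc (k' + 1) (v - 1) ∪ {2, 1}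

/-- `(k, k-1, …, 2, 1)` with the part `j` left out. -/
def pi21 (k j : ℕ) : Finset ℕ :=
  (Finset.Icc 1 k).erase j

/-- `(2k-j-1, k-2, k-3, …, 2, 1)`. -/
def pi22 (k j : ℕ) : Finset ℕ :=
  insert (2 * k - j - 1) (Finset.Icc 1 (k - 2))

/-- `(k, k-1, …, 3)`. -/
def pi23 (k : ℕ) : Finset ℕ :=
  Finset.Icc 3 k

/-- The existence condition of `pi12`. -/
def Exists12 (v k' j' : ℕ) : Prop :=
  k' + 1 ≤ 2 * k' - j' - 1 ∧ 2 * k' - j' - 1 ≤ v - 1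

/-- The existence condition of `pi13`. -/
def Exists13 (v j' : ℕ) : Prop := j' = 3 ∧ 4 ≤ v

/-- The existence condition of `pi22`. -/
def Exists22 (v k j : ℕ) : Prop :=
  k + 1 ≤ 2 * k - j - 1 ∧ 2 * k - j - 1 ≤ v - 1

/-- The existence condition of `pi23`. -/
def Exists23 (v j : ℕ) : Prop := j = 3 ∧ 4 ≤ v

/-!
Maximising the sum of squared degrees over graphs with `v` vertices and `e` edges.

A graph that maximises `P₂` admits no profitable replacement of an edge `bc` by `ac`, so its
neighbourhoods are nested and it has a dominating or an isolated vertex. Peeling such vertices off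
shows that `P₂` is bounded by its values on the threshold graphs `Th(π)`, where it is an explicit
function `sqSum π` of the partition: twice the sum of `x + y` over the cells `(x, y)` of the shifted
diagram of `π` (`exists_sqSum_ge`, `Th_spec`, `isOptimal_iff`). It remains to maximise `sqSum` over
`Dis(v, e)`.

The maximisers are found by induction on `v` (`IsMaximizer.isOneOfSix`). Complementation in
`{1, …, v - 1}` changes `sqSum` by a constant and exchanges the quasi-star with the quasi-complete
candidates (`sqSum_compl`, `IsOneOfSix.of_sdiff`), so `π` may be assumed to have the part `v - 1`.
Removing this part leaves a maximiser for `v - 1`, hence one of the six candidates. The three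
quasi-star candidates stay candidates when the part is put back. The three quasi-complete ones have
equal weight, so it suffices to understand `pi21 k j`. Here cells can be moved profitably: if `k` is
small compared with the removed row, from the last two columns of the triangle to the end of its
first row (`not_isMaximizer_pi21`, `not_isMaximizer_Icc`); otherwise, if the triangle is incomplete,
from the removed row to the last column of the triangle (`not_isMaximizer_insert_pi21`). What is left
is a full triangle below the removed row, which is a candidate of type `pi22` or `pi21`, and a few
cases where `k` is at most `3` or at least `v - 2`, which are candidates as well
(`isOneOfSix_insert_pi21`).

As a maximiser exists and the candidates of each kind have equal weight, `pi11` or `pi21` is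
optimal. Their threshold graphs are the quasi-star and the quasi-complete graph, so the comparison
of `S` and `C` decides which one is.
-/

open Finset

/-! ### The weight of a partition -/

/-- The sum of the squared degrees of `Th(π)` as a function of the partition alone. Row `s` of the
shifted diagram, with part `a`, occupies the cells `(s, s + 1), …, (s, s + a)`; giving every cell
`(x, y)` the weight `2 * (x + y)`, this row weighs `a * (a + 1) + 4 * a * s`, and `s` is the number
of parts exceeding `a`. `Th_spec` identifies it with `P2`. -/
def sqSum (π : Finset ℕ) : ℕ :=
  ∑ a ∈ π, (a * (a + 1) + 4 * (a * #{b ∈ π | a < b}))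

/-- Adding a new largest part prepends a row to the diagram, which shifts every old cell along the
diagonal and so raises each of their weights by `4`. -/
lemma sqSum_insert {n : ℕ} {ρ : Finset ℕ} (h : ∀ a ∈ ρ, a < n) :
    sqSum (insert n ρ) = sqSum ρ + n * (n + 1) + 4 * ∑ a ∈ ρ, a := by
  have hn : n ∉ ρ := fun hn => lt_irrefl _ (h n hn)
  have hf : ({b ∈ insert n ρ | n < b} : Finset ℕ) = ∅ := by
    ext b
    simp only [mem_filter, mem_insert, notMem_empty, iff_false, not_and]
    rintro (rfl | hb)
    · exact lt_irrefl _
    · exact (h b hb).not_gt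
  have hg : ∀ a ∈ ρ, #{b ∈ insert n ρ | a < b} = #{b ∈ ρ | a < b} + 1 := by
    intro a ha
    rw [filter_insert, if_pos (h a ha), card_insert_of_notMem (by simp [hn])]
  have hs : ∑ a ∈ ρ, (a * (a + 1) + 4 * (a * (#{b ∈ ρ | a < b} + 1)))
      = sqSum ρ + 4 * ∑ a ∈ ρ, a := by
    rw [sqSum, mul_sum, ← sum_add_distrib]
    exact sum_congr rfl fun a _ => by ring
  rw [sqSum, sum_insert hn, hf, sum_congr rfl fun a ha => by rw [hg a ha], hs, card_empty]
  ring

lemma sum_Icc_one (n : ℕ) : 2 * ∑ a ∈ Icc 1 n, a = n * (n + 1) := by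
  induction n with
  | zero => rfl
  | succ n ih => rw [sum_Icc_succ_top (by omega), mul_add, ih]; ring

lemma sqSum_Icc_one (n : ℕ) : sqSum (Icc 1 n) = n ^ 2 * (n + 1) := by
  induction n with
  | zero => rfl
  | succ n ih =>
    rw [← insert_Icc_right_eq_Icc_add_one (by omega),
      sqSum_insert (fun a ha => by simp at ha; omega), ih]
    linarith [sum_Icc_one n]

lemma pi21_self (k : ℕ) : pi21 k k = Icc 1 (k - 1) := by
  ext a; simp [pi21]; omega

lemma pi21_succ {k j : ℕ} (h : j ≤ k) : pi21 (k + 1) j = insert (k + 1) (pi21 k j) := by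
  ext a; simp [pi21]; omega

/-- The equation `∑ a = k(k+1)/2 - j`, without division and subtraction. -/
lemma sum_pi21 {k j : ℕ} (hj : 1 ≤ j) (hjk : j ≤ k) :
    2 * ∑ a ∈ pi21 k j, a + 2 * j = k * (k + 1) := by
  rw [← mul_add, pi21, sum_erase_add _ _ (by simp; omega), sum_Icc_one]

/-- The quasi-complete value: `k - j` vertices of degree `k`, `j` of degree `k - 1`, one of degree
`k - j`. -/
lemma sqSum_pi21 {k j : ℕ} (hj : 1 ≤ j) (hjk : j ≤ k) :
    (sqSum (pi21 k j) : ℤ) = (k - j : ℤ) ^ 2 + (k - j) * k ^ 2 + j * (k - 1) ^ 2 := by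
  induction k, hjk using Nat.le_induction with
  | base =>
    obtain ⟨i, rfl⟩ := Nat.exists_eq_add_of_le' hj
    rw [pi21_self, sqSum_Icc_one]
    push_cast [Nat.add_sub_cancel]
    ring
  | succ k hjk ih =>
    have h := sum_pi21 hj hjk
    zify at h
    rw [pi21_succ hjk, sqSum_insert (fun a ha => by simp [pi21] at ha; omega)]
    push_cast
    rw [ih]
    linarith

lemma sqSum_pi22 {k j : ℕ} (hj : j + 2 ≤ k) (hj1 : 1 ≤ j) :
    sqSum (pi22 k j) = sqSum (pi21 k j) := by
  have h1 := sqSum_pi21 hj1 (by omega : j ≤ k)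
  obtain ⟨d, rfl⟩ := Nat.exists_eq_add_of_le hj
  have h2 := sum_Icc_one (j + d)
  zify at h2 ⊢
  rw [h1, pi22, sqSum_insert (fun a ha => by simp at ha; omega), sqSum_Icc_one,
    show 2 * (j + 2 + d) - j - 1 = j + 2 * d + 3 by omega, show j + 2 + d - 2 = j + d by omega]
  push_cast
  linarith

lemma sqSum_pi23 {k : ℕ} (hk : 3 ≤ k) : sqSum (pi23 k) = sqSum (pi21 k 3) := by
  have key : sqSum (pi23 k) = sqSum (pi21 k 3) ∧ ∑ a ∈ pi23 k, a = ∑ a ∈ pi21 k 3, a := by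
    induction k, hk using Nat.le_induction with
    | base => decide
    | succ k hk ih =>
      have h3 : pi23 (k + 1) = insert (k + 1) (pi23 k) := by
        ext a; simp [pi23]; omega
      rw [h3, pi21_succ hk, sqSum_insert (fun a ha => by simp [pi23] at ha; omega),
        sqSum_insert (fun a ha => by simp [pi21] at ha; omega),
        sum_insert (by simp [pi23]), sum_insert (by simp [pi21])]
      omega
  exact key.1

lemma sum_sdiff_Icc {n : ℕ} {π : Finset ℕ} (h : π ⊆ Icc 1 n) :
    2 * ∑ a ∈ Icc 1 n \ π, a + 2 * ∑ a ∈ π, a = n * (n + 1) := by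
  rw [← mul_add, sum_sdiff h, sum_Icc_one]

/-- Complementation inside `{1, …, n}` changes `sqSum` by a quantity that depends only on `n` and on
the number of edges, just as `P₂` changes under graph complementation. -/
lemma sqSum_compl {n : ℕ} {π : Finset ℕ} (h : π ⊆ Icc 1 n) :
    sqSum (Icc 1 n \ π) + 4 * n * ∑ a ∈ π, a = sqSum π + n ^ 2 * (n + 1) := by
  induction n generalizing π with
  | zero =>
    obtain rfl : π = ∅ := by simpa using h
    rfl
  | succ n ih =>
    by_cases hn : n + 1 ∈ π
    · obtain ⟨ρ, hρ, rfl⟩ : ∃ ρ ⊆ Icc 1 n, insert (n + 1) ρ = π := by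
        refine ⟨π.erase (n + 1), fun a ha => ?_, insert_erase hn⟩
        have := h (mem_of_mem_erase ha)
        have := ne_of_mem_erase ha
        simp at *; omega
      have hlt : ∀ a ∈ ρ, a < n + 1 := fun a ha => by have := hρ ha; simp at this; omega
      have hc : Icc 1 (n + 1) \ insert (n + 1) ρ = Icc 1 n \ ρ := by
        ext a; simp only [mem_sdiff, mem_Icc, mem_insert]; grind
      rw [hc, sqSum_insert hlt, sum_insert (fun hm => lt_irrefl _ (hlt _ hm))]
      linarith [ih hρ]
    · have hρ : π ⊆ Icc 1 n := fun a ha => by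
        have := h ha
        have : a ≠ n + 1 := fun h => hn (h ▸ ha)
        simp at *; omega
      have hc : Icc 1 (n + 1) \ π = insert (n + 1) (Icc 1 n \ π) := by
        ext a; simp only [mem_sdiff, mem_Icc, mem_insert]; grind
      rw [hc, sqSum_insert (fun a ha => by simp at ha; omega)]
      linarith [ih hρ, sum_sdiff_Icc hρ]

/-! ### Triangular numbers -/

lemma two_mul_choose_two (n : ℕ) : 2 * (n + 1).choose 2 = n * (n + 1) := by
  induction n with
  | zero => rfl
  | succ n ih => rw [Nat.choose_succ_succ' (n + 1) 1, Nat.choose_one_right, mul_add, ih]; ring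

lemma choose_two_succ (n : ℕ) : (n + 1).choose 2 = n + n.choose 2 := by
  rw [Nat.choose_succ_succ' n 1, Nat.choose_one_right]

lemma existsUnique_triangular (e : ℕ) :
    ∃! p : ℕ × ℕ, 1 ≤ p.2 ∧ p.2 ≤ p.1 ∧ e + p.2 = (p.1 + 1).choose 2 := by
  have key : ∃ p : ℕ × ℕ, 1 ≤ p.2 ∧ p.2 ≤ p.1 ∧ e + p.2 = (p.1 + 1).choose 2 := by
    induction e with
    | zero => exact ⟨(1, 1), by decide⟩
    | succ e ih =>
      obtain ⟨⟨k, j⟩, h1, h2, h3⟩ := ih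
      dsimp only at h1 h2 h3
      rcases Nat.lt_or_ge 1 j with h | h
      · exact ⟨(k, j - 1), by dsimp only; omega⟩
      · refine ⟨(k + 1, k + 1), by dsimp only; omega, le_rfl, ?_⟩
        have := choose_two_succ (k + 1)
        dsimp only; omega
  obtain ⟨p, hp⟩ := key
  have lt_absurd : ∀ p q : ℕ × ℕ, (1 ≤ p.2 ∧ p.2 ≤ p.1 ∧ e + p.2 = (p.1 + 1).choose 2) →
      (1 ≤ q.2 ∧ q.2 ≤ q.1 ∧ e + q.2 = (q.1 + 1).choose 2) → ¬ p.1 < q.1 := by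
    rintro ⟨k, j⟩ ⟨k', j'⟩ ⟨h1, h2, h3⟩ ⟨h1', h2', h3'⟩ hlt
    dsimp only at *
    have := Nat.choose_le_choose 2 (by omega : k + 1 ≤ k')
    have h := choose_two_succ k'
    omega
  refine ⟨p, hp, fun q hq => ?_⟩
  have h1 : q.1 = p.1 :=
    le_antisymm (not_lt.1 (lt_absurd p q hp hq)) (not_lt.1 (lt_absurd q p hq hp))
  have h2 := hp.2.2
  have h3 := hq.2.2
  rw [h1] at h3
  exact Prod.ext h1 (by omega)

lemma triangular_unique {e k j k' j' : ℕ} (h1 : 1 ≤ j) (h2 : j ≤ k)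
    (h3 : e + j = (k + 1).choose 2) (h1' : 1 ≤ j') (h2' : j' ≤ k')
    (h3' : e + j' = (k' + 1).choose 2) : k = k' ∧ j = j' := by
  have := (existsUnique_triangular e).unique (y₁ := (k, j)) (y₂ := (k', j'))
    ⟨h1, h2, h3⟩ ⟨h1', h2', h3'⟩
  simpa using this

/-! ### Maximisers and the six candidates -/

/-- `π` maximises `sqSum` over `Dis(v, e)`; by `isOptimal_iff` this is optimality. -/
def IsMaximizer (v e : ℕ) (π : Finset ℕ) : Prop :=
  π ∈ Dis v e ∧ ∀ ρ ∈ Dis v e, sqSum ρ ≤ sqSum π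

/-- `π` is one of the six candidate partitions for the parameters `k, j, k', j'`, and the existence
condition of the candidate holds. -/
def IsOneOfSix (v k j k' j' : ℕ) (π : Finset ℕ) : Prop :=
  π = pi11 v k' j' ∨
  (Exists12 v k' j' ∧ π = pi12 v k' j') ∨
  (Exists13 v j' ∧ π = pi13 v k') ∨
  π = pi21 k j ∨
  (Exists22 v k j ∧ π = pi22 k j) ∨
  (Exists23 v j ∧ π = pi23 k)

lemma Dis.lt {v e a : ℕ} {π : Finset ℕ} (h : π ∈ Dis v e) (ha : a ∈ π) : a < v := (h.1 a ha).2

lemma Dis.subset_Icc {n e : ℕ} {π : Finset ℕ} (h : π ∈ Dis (n + 1) e) : π ⊆ Icc 1 n :=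
  fun a ha => by have := h.1 a ha; simp; omega

lemma Dis.insert_mem {n e : ℕ} {ρ : Finset ℕ} (hn : 0 < n) (h : ρ ∈ Dis n e) :
    insert n ρ ∈ Dis (n + 1) (e + n) := by
  refine ⟨fun a ha => ?_, ?_⟩
  · rcases mem_insert.1 ha with rfl | ha
    · omega
    · have := h.1 a ha; omega
  · rw [sum_insert (fun hm => lt_irrefl _ (Dis.lt h hm)), h.2, add_comm]

lemma Dis.erase_mem {n e : ℕ} {π : Finset ℕ} (h : π ∈ Dis (n + 1) (e + n)) (hn : n ∈ π) :
    π.erase n ∈ Dis n e := by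
  refine ⟨fun a ha => ?_, ?_⟩
  · have := h.1 a (mem_of_mem_erase ha)
    have := ne_of_mem_erase ha
    omega
  · have := add_sum_erase π (fun a => a) hn
    have := h.2
    omega

lemma Dis.sqSum_insert {n e : ℕ} {ρ : Finset ℕ} (h : ρ ∈ Dis n e) :
    sqSum (insert n ρ) = sqSum ρ + n * (n + 1) + 4 * e := by
  rw [_root_.sqSum_insert fun a ha => Dis.lt h ha, h.2]

lemma Dis.sdiff_mem {n e : ℕ} {π : Finset ℕ} (h : π ∈ Dis (n + 1) e) :
    Icc 1 n \ π ∈ Dis (n + 1) ((n + 1).choose 2 - e) := by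
  refine ⟨fun a ha => by simp at ha; omega, ?_⟩
  have := sum_sdiff_Icc (Dis.subset_Icc h)
  have := two_mul_choose_two n
  have := h.2
  omega

lemma Dis.le_choose {n e : ℕ} {π : Finset ℕ} (h : π ∈ Dis (n + 1) e) :
    e ≤ (n + 1).choose 2 := by
  have := sum_sdiff_Icc (Dis.subset_Icc h)
  have := two_mul_choose_two n
  have := h.2
  omega

lemma IsMaximizer.sdiff {n e : ℕ} {π : Finset ℕ} (h : IsMaximizer (n + 1) e π) :
    IsMaximizer (n + 1) ((n + 1).choose 2 - e) (Icc 1 n \ π) := by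
  refine ⟨Dis.sdiff_mem h.1, fun ρ hρ => ?_⟩
  have hle := Dis.le_choose h.1
  have h1 := Dis.sdiff_mem hρ
  rw [Nat.sub_sub_self hle] at h1
  have h2 := h.2 _ h1
  have h3 := sqSum_compl (Dis.subset_Icc h.1)
  have h4 := sqSum_compl (Dis.subset_Icc h1)
  rw [h.1.2] at h3
  rw [h1.2, Finset.sdiff_sdiff_eq_self (Dis.subset_Icc hρ)] at h4
  omega

/-- Removing a dominating first row preserves maximality, since it costs a constant. -/
lemma IsMaximizer.erase {n e : ℕ} {ρ : Finset ℕ} (hn : 0 < n) (hρ : ρ ∈ Dis n e)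
    (h : IsMaximizer (n + 1) (e + n) (insert n ρ)) : IsMaximizer n e ρ := by
  refine ⟨hρ, fun σ hσ => ?_⟩
  have := h.2 _ (Dis.insert_mem hn hσ)
  rw [Dis.sqSum_insert hσ, Dis.sqSum_insert hρ] at this
  omega

lemma sdiff_pi21 {n k j : ℕ} (hj : 1 ≤ j) (hjk : j ≤ k) (hk : k ≤ n + 1) (hkj : k = n + 1 → j = k) :
    Icc 1 n \ pi21 k j = pi11 (n + 1) k j := by
  unfold pi21 pi11
  split_ifs with h
  · ext a; simp; omega
  · ext a; simp; omega

lemma sdiff_pi22 {n k j : ℕ} (hj : 1 ≤ j) (h : Exists22 (n + 1) k j) :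
    Icc 1 n \ pi22 k j = pi12 (n + 1) k j := by
  unfold Exists22 at h
  unfold pi22 pi12
  ext a; simp; omega

lemma sdiff_pi23 {n k : ℕ} (hk : 3 ≤ k) (hkn : k ≤ n) :
    Icc 1 n \ pi23 k = pi13 (n + 1) k := by
  unfold pi23 pi13
  ext a; simp; omega

lemma pi21_subset {n k j : ℕ} (hk : k ≤ n + 1) (hkj : k = n + 1 → j = k) :
    pi21 k j ⊆ Icc 1 n := fun a ha => by simp [pi21] at *; omega

lemma pi22_subset {n k j : ℕ} (h : Exists22 (n + 1) k j) :
    pi22 k j ⊆ Icc 1 n := fun a ha => by unfold Exists22 at h; simp [pi22] at *; omega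

lemma pi23_subset {n k : ℕ} (hk : k ≤ n) :
    pi23 k ⊆ Icc 1 n := fun a ha => by simp [pi23] at *; omega

/-- A graph on `v` vertices has room for the parameter `k`; the extreme case `k = v` is a complete
graph, for which `j = v` and the part `k` is the omitted one. -/
lemma triangular_le {v e k j : ℕ} (hv : 0 < v) (he : e ≤ v.choose 2) (h2 : j ≤ k)
    (h3 : e + j = (k + 1).choose 2) : k ≤ v ∧ (k = v → j = k) := by
  have h := choose_two_succ k
  constructor
  · by_contra hlt
    have h4 := Nat.choose_le_choose 2 (by omega : v + 1 ≤ k)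
    have h5 := choose_two_succ v
    omega
  · rintro rfl; omega

/-! ### Competitors with larger weight -/

/-- If `n` is large compared with `k`, then lengthening the first row of `pi21 k j` at the expense of
its last two columns is profitable. First, the last column is moved to the end of the first row,
which gives `pi22 k j` at no cost; moving also the lowest `r` cells of the next column gains
`2 * r * (r + 2 - j)` in total. -/
lemma not_isMaximizer_pi21 {n e k j : ℕ} (hj : 1 ≤ j) (hjk : j < k) (hk : 3 ≤ k)
    (hn : 2 * k + 1 ≤ n) : ¬ IsMaximizer n e (pi21 k j) := by
  intro h
  -- `r` is as large as the height of the second to last column and the bound `n` on the first row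
  -- allow.
  obtain ⟨r, hr1, hr2, hr3, hr4⟩ : ∃ r, 1 ≤ r ∧ r ≤ k - 2 ∧ 2 * k - j - 1 + r < n ∧
      j < r + 2 := by
    rcases le_total (k - 2) (n + j - 2 * k) with h | h
    · exact ⟨k - 2, by omega⟩
    · exact ⟨n + j - 2 * k, by omega⟩
  obtain ⟨k, rfl⟩ := Nat.exists_eq_add_of_le' (by omega : 2 ≤ k)
  have h1 := sum_pi21 hj hjk.le
  have h2 := sum_pi21 hr1 hr2
  have h3 := sqSum_pi21 hj hjk.le
  have h4 := sqSum_pi21 hr1 hr2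
  rw [h.1.2] at h1
  simp only [Nat.add_sub_cancel] at *
  -- `m` is the first row of `pi22`, and omitting the part `r` from the triangle `k, …, 1` removes
  -- the lowest `r` cells of its last column.
  obtain ⟨m, hm⟩ : ∃ m, 2 * (k + 2) = m + j + 1 := ⟨2 * (k + 2) - j - 1, by omega⟩
  rw [show 2 * (k + 2) - j - 1 = m by omega] at hr3
  have hlt : ∀ a ∈ pi21 k r, a < m + r := fun a ha => by simp [pi21] at ha; omega
  have hmem : insert (m + r) (pi21 k r) ∈ Dis n e := by
    refine ⟨fun a ha => ?_, ?_⟩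
    · simp [pi21] at ha; omega
    · rw [sum_insert (fun hm => lt_irrefl _ (hlt _ hm))]
      linarith
  have h5 := h.2 _ hmem
  rw [sqSum_insert hlt] at h5
  zify at *
  have hm' : (m : ℤ) = 2 * (k + 2) - j - 1 := by linarith
  rw [hm'] at h5
  nlinarith [mul_pos (by linarith : (0 : ℤ) < r) (by linarith : (0 : ℤ) < r + 2 - j)]

/-- The analogue of `not_isMaximizer_pi21` for a full triangle: after the last column has been moved to
the end of the first row, moving the bottom cell of the triangle there is a strict gain. -/
lemma not_isMaximizer_Icc {n e k : ℕ} (hk : 3 ≤ k) (hn : 2 * k + 1 ≤ n) :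
    ¬ IsMaximizer n e (Icc 1 k) := by
  intro h
  obtain ⟨k, rfl⟩ := Nat.exists_eq_add_of_le' hk
  have h1 := sum_Icc_one (k + 3)
  have h2 := sum_pi21 le_rfl (by omega : 1 ≤ k + 1)
  have h3 := sqSum_Icc_one (k + 3)
  have h4 := sqSum_pi21 le_rfl (by omega : 1 ≤ k + 1)
  rw [h.1.2] at h1
  have hlt : ∀ a ∈ pi21 (k + 1) 1, a < 2 * k + 6 := fun a ha => by simp [pi21] at ha; omega
  have hmem : insert (2 * k + 6) (pi21 (k + 1) 1) ∈ Dis n e := by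
    refine ⟨fun a ha => ?_, ?_⟩
    · simp [pi21] at ha; omega
    · rw [sum_insert (fun hm => lt_irrefl _ (hlt _ hm))]
      linarith
  have h5 := h.2 _ hmem
  rw [sqSum_insert hlt] at h5
  zify at *
  push_cast at *
  nlinarith

/-- If `k` is large compared with `n`, then a dominating first row on top of an incomplete triangle is
not profitable: cells from the end of that row are better used to fill up the last column of the
triangle, as far as the parts stay distinct. -/
lemma not_isMaximizer_insert_pi21 {n e k j : ℕ} (hj : 1 ≤ j) (hjk : j < k)
    (hk : k + 2 ≤ n) (hn : n ≤ 2 * k) : ¬ IsMaximizer (n + 1) e (insert n (pi21 k j)) := by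
  intro h
  have hlt : ∀ a ∈ pi21 k j, a < n := fun a ha => by simp [pi21] at ha; omega
  have h0 := h.1.2
  have h1 := sum_pi21 hj hjk.le
  have h3 := sqSum_pi21 hj hjk.le
  have h6 := sqSum_insert hlt
  rw [sum_insert (fun hm => lt_irrefl _ (hlt _ hm))] at h0
  -- The last column of the triangle lacks `j` cells. Either the first row can supply all of them,
  -- or it supplies `n - k - 1` cells and is left with the part `k + 1`.
  rcases lt_or_ge k (n - j) with hc | hc
  · obtain ⟨d, rfl⟩ := Nat.exists_eq_add_of_le (by omega : j ≤ n)
    have h2 := sum_Icc_one k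
    have h4 := sqSum_Icc_one k
    have hlt' : ∀ a ∈ Icc 1 k, a < d := fun a ha => by simp at ha; omega
    have hmem : insert d (Icc 1 k) ∈ Dis (j + d + 1) e := by
      refine ⟨fun a ha => ?_, ?_⟩
      · simp at ha; omega
      · rw [sum_insert (fun hm => lt_irrefl _ (hlt' _ hm))]
        linarith
    have h5 := h.2 _ hmem
    rw [sqSum_insert hlt'] at h5
    zify at *
    nlinarith [mul_pos (by linarith : (0 : ℤ) < j) (by linarith : (0 : ℤ) < 2 * k + 1 - (j + d))]
  · obtain ⟨r, rfl⟩ := Nat.exists_eq_add_of_le (by omega : k + 1 ≤ n)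
    obtain ⟨i, rfl⟩ := Nat.exists_eq_add_of_le (by omega : r ≤ j)
    have h2 := sum_pi21 (by omega : 1 ≤ i) (by omega : i ≤ k + 1)
    have h4 := sqSum_pi21 (by omega : 1 ≤ i) (by omega : i ≤ k + 1)
    have hmem : pi21 (k + 1) i ∈ Dis (k + 1 + r + 1) e := by
      refine ⟨fun a ha => ?_, ?_⟩
      · simp [pi21] at ha; omega
      · linarith
    have h5 := h.2 _ hmem
    zify at *
    nlinarith [mul_pos (by linarith : (0 : ℤ) < r) (by linarith : (0 : ℤ) < k - (r + i))]

/-! ### Classification of the maximisers -/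

/-- If a quasi-complete partition with a dominating row prepended is maximal, then it is again one
of the six: of type `pi22` if the triangle is full and of intermediate size, and of type `pi11`,
`pi13` or `pi21` if the triangle is very small or very large. -/
lemma isOneOfSix_insert_pi21 {n e k j K J k' j' : ℕ} (hn : 0 < n)
    (hj : 1 ≤ j) (hjk : j ≤ k) (hkj : e + j = (k + 1).choose 2)
    (hJ : 1 ≤ J) (hJK : J ≤ K) (hKJ : e + n + J = (K + 1).choose 2)
    (hj' : 1 ≤ j') (hjk' : j' ≤ k')
    (hkj' : e + (k' + 1).choose 2 = n.choose 2 + j')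
    (hm : IsMaximizer n e (pi21 k j)) (hM : IsMaximizer (n + 1) (e + n) (insert n (pi21 k j))) :
    IsOneOfSix (n + 1) K J k' j' (insert n (pi21 k j)) := by
  have hkn : k ≤ n ∧ (k = n → j = k) := by
    obtain ⟨n, rfl⟩ := Nat.exists_eq_add_of_le' hn
    exact triangular_le (by omega) (Dis.le_choose hm.1) hjk hkj
  have hK : ∀ {a b : ℕ}, 1 ≤ b → b ≤ a → e + n + b = (a + 1).choose 2 → K = a ∧ J = b :=
    fun h1 h2 h3 => triangular_unique hJ hJK hKJ h1 h2 h3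
  have hK' : ∀ {a b : ℕ}, 1 ≤ b → b ≤ a → e + (a + 1).choose 2 = n.choose 2 + b →
      k' = a ∧ j' = b := fun {a b} h1 h2 h3 => by
    have hle : e ≤ n.choose 2 := by
      obtain ⟨n, rfl⟩ := Nat.exists_eq_add_of_le' hn
      exact Dis.le_choose hm.1
    exact triangular_unique (e := n.choose 2 - e) hj' hjk' (by omega) h1 h2 (by omega)
  have hcn := choose_two_succ n
  have hck := choose_two_succ k
  have hck' := choose_two_succ (k - 1)
  rw [Nat.sub_add_cancel (by omega)] at hck'
  rcases hjk.eq_or_lt with rfl | hlt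
  · -- Below the first row there is the full triangle `j - 1, …, 1`.
    rw [pi21_self] at hm hM ⊢
    rcases hkn.1.eq_or_lt with rfl | hkn1
    · right; right; right; left
      obtain ⟨rfl, rfl⟩ := hK (a := j + 1) (b := j + 1) (by omega) le_rfl
        (by have := choose_two_succ (j + 1); omega)
      rw [pi21_self]
      ext a; simp; omega
    · by_cases hj3 : j ≤ 3
      · interval_cases j
        · left
          obtain ⟨rfl, rfl⟩ := hK' (a := n) (b := n) (by omega) le_rfl
            (by norm_num at *; omega)
          unfold pi11
          ext a; simp
        · left
          obtain ⟨rfl, rfl⟩ := hK' (a := n - 1) (b := 1) (by omega) (by omega)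
            (by have := choose_two_succ (n - 1); rw [Nat.sub_add_cancel hn] at *
                norm_num at *; omega)
          unfold pi11
          ext a; simp; omega
        · right; right; left
          obtain ⟨rfl, rfl⟩ := hK' (a := n - 1) (b := 3) (by omega) (by omega)
            (by have := choose_two_succ (n - 1); rw [Nat.sub_add_cancel hn] at *
                norm_num [Nat.choose] at *; omega)
          refine ⟨⟨rfl, by omega⟩, ?_⟩
          unfold pi13
          ext a; simp; omega
      · have hn2 : n < 2 * (j - 1) + 1 := by
          by_contra hn2
          exact not_isMaximizer_Icc (by omega) (by omega) hm
        have h1 := choose_two_succ (j + 1)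
        rcases (by omega : n = j + 1 ∨ j + 2 ≤ n) with rfl | hn3
        · right; right; right; left
          obtain ⟨rfl, rfl⟩ := hK (a := j + 1) (b := j) (by omega) (by omega) (by omega)
          unfold pi21
          ext a; simp; omega
        · right; right; right; right; left
          obtain ⟨rfl, rfl⟩ := hK (a := j + 1) (b := 2 * j + 1 - n) (by omega) (by omega)
            (by omega)
          refine ⟨⟨by omega, by omega⟩, ?_⟩
          unfold pi22
          ext a; simp; omega
  · by_cases hkn2 : k + 2 ≤ n
    · have hn2 : 2 * k + 1 ≤ n := by
        by_contra hn2
        exact not_isMaximizer_insert_pi21 hj hlt hkn2 (by omega) hM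
      have hk2 : k = 2 := by
        by_contra hk2
        exact not_isMaximizer_pi21 hj hlt (by omega) hn2 hm
      subst hk2
      obtain rfl : j = 1 := by omega
      left
      obtain ⟨rfl, rfl⟩ := hK' (a := n - 1) (b := 2) (by omega) (by omega)
        (by have := choose_two_succ (n - 1); rw [Nat.sub_add_cancel hn] at *
            norm_num [Nat.choose] at *; omega)
      unfold pi11 pi21
      ext a; simp; omega
    · obtain rfl : n = k + 1 := by omega
      right; right; right; left
      obtain ⟨rfl, rfl⟩ := hK (a := k + 1) (b := j) (by omega) (by omega)
        (by have := choose_two_succ (k + 1); omega)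
      rw [pi21_succ hjk]

lemma IsMaximizer.congr {v e : ℕ} {π ρ : Finset ℕ} (h : IsMaximizer v e π) (hρ : ρ ∈ Dis v e)
    (heq : sqSum ρ = sqSum π) : IsMaximizer v e ρ :=
  ⟨hρ, fun σ hσ => (h.2 σ hσ).trans heq.ge⟩

lemma pi21_mem_Dis {v e k j : ℕ} (hv : 0 < v) (he : e ≤ v.choose 2) (hj : 1 ≤ j) (hjk : j ≤ k)
    (h : e + j = (k + 1).choose 2) : pi21 k j ∈ Dis v e := by
  have := triangular_le hv he hjk h
  refine ⟨fun a ha => by simp [pi21] at ha; omega, ?_⟩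
  have := sum_pi21 hj hjk
  have := two_mul_choose_two k
  omega

lemma pi22_mem_Dis {v e k j : ℕ} (hj : 1 ≤ j)
    (h : e + j = (k + 1).choose 2) (hex : Exists22 v k j) : pi22 k j ∈ Dis v e := by
  unfold Exists22 at hex
  refine ⟨fun a ha => by simp [pi22] at ha; omega, ?_⟩
  obtain ⟨k, rfl⟩ := Nat.exists_eq_add_of_le' (by omega : 2 ≤ k)
  have h1 := sum_Icc_one k
  have h2 := two_mul_choose_two k
  have h3 : (k + 2).choose 2 = k + 1 + (k + 1).choose 2 := choose_two_succ (k + 1)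
  have h4 : (k + 2 + 1).choose 2 = k + 2 + (k + 2).choose 2 := choose_two_succ (k + 2)
  rw [pi22, sum_insert (by simp; omega), Nat.add_sub_cancel]
  omega

lemma sum_pi23 {k : ℕ} (hk : 3 ≤ k) : ∑ a ∈ pi23 k, a + 3 = (k + 1).choose 2 := by
  induction k, hk using Nat.le_induction with
  | base => decide
  | succ k hk ih =>
    have h3 : pi23 (k + 1) = insert (k + 1) (pi23 k) := by
      ext a; simp [pi23]; omega
    rw [h3, sum_insert (by simp [pi23]), choose_two_succ (k + 1)]
    omega

lemma pi23_mem_Dis {v e k j : ℕ} (he : e ≤ v.choose 2) (hjk : j ≤ k)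
    (h : e + j = (k + 1).choose 2) (hex : Exists23 v j) : pi23 k ∈ Dis v e := by
  obtain ⟨rfl, hv⟩ := hex
  have := triangular_le (by omega) he hjk h
  have := sum_pi23 hjk
  exact ⟨fun a ha => by simp [pi23] at ha; omega, by omega⟩

/-- The inductive step for a dominating first row. The quasi-star types persist. The types of
`pi22` and `pi23` are reduced to that of `pi21`, because their `sqSum` is the same before and after
the row is prepended. -/
lemma isOneOfSix_insert {n e k j K J k' j' : ℕ} {ρ : Finset ℕ} (hn : 0 < n)
    (hj : 1 ≤ j) (hjk : j ≤ k) (hkj : e + j = (k + 1).choose 2)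
    (hJ : 1 ≤ J) (hJK : J ≤ K) (hKJ : e + n + J = (K + 1).choose 2)
    (hj' : 1 ≤ j') (hjk' : j' ≤ k')
    (hkj' : e + (k' + 1).choose 2 = n.choose 2 + j')
    (hm : IsMaximizer n e ρ) (hM : IsMaximizer (n + 1) (e + n) (insert n ρ))
    (h6 : IsOneOfSix n k j k' j' ρ) :
    IsOneOfSix (n + 1) K J k' j' (insert n ρ) := by
  have he : e ≤ n.choose 2 := by
    obtain ⟨n, rfl⟩ := Nat.exists_eq_add_of_le' hn
    exact Dis.le_choose hm.1
  have hk'n := triangular_le hn (Nat.sub_le _ e) hjk' (by omega : n.choose 2 - e + j' = _)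
  have hkn := triangular_le hn he hjk hkj
  have h21 : ∀ σ ∈ Dis n e, sqSum σ = sqSum ρ → IsMaximizer n e σ ∧
      IsMaximizer (n + 1) (e + n) (insert n σ) := fun σ hσ heq =>
    ⟨hm.congr hσ heq, hM.congr (Dis.insert_mem hn hσ) (by
      rw [Dis.sqSum_insert hσ, Dis.sqSum_insert hm.1, heq])⟩
  rcases h6 with rfl | ⟨hex, rfl⟩ | ⟨hex, rfl⟩ | rfl | ⟨hex, rfl⟩ | ⟨hex, rfl⟩
  · left
    unfold pi11
    split_ifs <;> (ext a; simp; omega)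
  · right; left
    unfold Exists12 at *
    refine ⟨by omega, ?_⟩
    unfold pi12
    ext a; simp; omega
  · right; right; left
    unfold Exists13 at *
    refine ⟨by omega, ?_⟩
    unfold pi13
    ext a; simp; omega
  · exact isOneOfSix_insert_pi21 hn hj hjk hkj hJ hJK hKJ hj' hjk' hkj' hm hM
  · exfalso
    unfold Exists22 at hex
    obtain ⟨h1, h2⟩ := h21 _ (pi21_mem_Dis hn he hj hjk hkj) (sqSum_pi22 (by omega) hj).symm
    rcases le_or_gt (2 * k + 1) n with hc | hc
    · exact not_isMaximizer_pi21 hj (by omega) (by omega) hc h1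
    · exact not_isMaximizer_insert_pi21 hj (by omega) (by omega) (by omega) h2
  · obtain ⟨rfl, hn4⟩ := hex
    obtain ⟨h1, h2⟩ := h21 _ (pi21_mem_Dis hn he hj hjk hkj) (sqSum_pi23 hjk).symm
    rcases hjk.eq_or_lt with rfl | hlt
    · left
      have hck := choose_two_succ (n - 1)
      rw [Nat.sub_add_cancel hn] at hck
      norm_num [Nat.choose] at hkj
      obtain ⟨rfl, rfl⟩ := triangular_unique (e := n.choose 2 - e) (k := k') (k' := n - 1)
        (j' := 3) hj' hjk' (by omega) (by omega) (by omega)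
        (by rw [Nat.sub_add_cancel hn]; omega)
      unfold pi11 pi23
      ext a; simp; omega
    · by_cases hkn2 : k + 2 ≤ n
      · rcases le_or_gt (2 * k + 1) n with hc | hc
        · exact (not_isMaximizer_pi21 hj hlt (by omega) hc h1).elim
        · exact (not_isMaximizer_insert_pi21 hj hlt hkn2 (by omega) h2).elim
      · obtain rfl : n = k + 1 := by omega
        obtain ⟨rfl, rfl⟩ := triangular_unique (j' := 3) (k' := k + 1) hJ hJK hKJ (by omega)
          (by omega) (by have := choose_two_succ (k + 1); omega)
        right; right; right; right; right
        refine ⟨⟨rfl, by omega⟩, ?_⟩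
        unfold pi23
        ext a; simp; omega

/-- Complementation exchanges the first three of the six partitions with the last three. -/
lemma IsOneOfSix.of_sdiff {n k j k' j' : ℕ} {π : Finset ℕ} (hπ : π ⊆ Icc 1 n)
    (hj : 1 ≤ j) (hjk : j ≤ k) (hk : k ≤ n + 1 ∧ (k = n + 1 → j = k))
    (hj' : 1 ≤ j') (hjk' : j' ≤ k') (hk' : k' ≤ n + 1 ∧ (k' = n + 1 → j' = k'))
    (h : IsOneOfSix (n + 1) k' j' k j (Icc 1 n \ π)) : IsOneOfSix (n + 1) k j k' j' π := by
  have inv : ∀ {σ τ : Finset ℕ}, σ ⊆ Icc 1 n → Icc 1 n \ σ = τ → Icc 1 n \ π = τ → π = σ := by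
    rintro σ τ hσ rfl h
    rw [← Finset.sdiff_sdiff_eq_self hπ, h, Finset.sdiff_sdiff_eq_self hσ]
  have inv' : ∀ {σ τ : Finset ℕ}, Icc 1 n \ σ = τ → Icc 1 n \ π = σ → π = τ := by
    rintro σ τ rfl h
    rw [← h, Finset.sdiff_sdiff_eq_self hπ]
  rcases h with h | ⟨hex, h⟩ | ⟨hex, h⟩ | h | ⟨hex, h⟩ | ⟨hex, h⟩
  · right; right; right; left
    exact inv (pi21_subset hk.1 hk.2) (sdiff_pi21 hj hjk hk.1 hk.2) h
  · right; right; right; right; left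
    exact ⟨hex, inv (pi22_subset hex) (sdiff_pi22 hj hex) h⟩
  · right; right; right; right; right
    have := hex
    unfold Exists13 at this
    exact ⟨hex, inv (pi23_subset (by omega)) (sdiff_pi23 (by omega) (by omega)) h⟩
  · left
    exact inv' (sdiff_pi21 hj' hjk' hk'.1 hk'.2) h
  · right; left
    exact ⟨hex, inv' (sdiff_pi22 hj' hex) h⟩
  · right; right; left
    have := hex
    unfold Exists23 at this
    exact ⟨hex, inv' (sdiff_pi23 (by omega) (by omega)) h⟩

/-- Every maximiser is one of the six: either the partition or its complement has the largest possible
part, which can be removed. -/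
theorem IsMaximizer.isOneOfSix {v e k j k' j' : ℕ} {π : Finset ℕ} (hv : 0 < v)
    (hj : 1 ≤ j) (hjk : j ≤ k) (hkj : e + j = (k + 1).choose 2)
    (hj' : 1 ≤ j') (hjk' : j' ≤ k') (hkj' : e + (k' + 1).choose 2 = v.choose 2 + j')
    (h : IsMaximizer v e π) : IsOneOfSix v k j k' j' π := by
  induction v, hv using Nat.le_induction generalizing e k j k' j' π with
  | base =>
    obtain rfl : π = ∅ := by simpa using Dis.subset_Icc h.1
    obtain rfl : e = 0 := h.1.2.symm
    obtain ⟨rfl, rfl⟩ := triangular_unique (k' := 1) (j' := 1) hj' hjk'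
      (by simpa using hkj'.symm.trans rfl)
      le_rfl le_rfl rfl
    left; rfl
  | succ n hn ih =>
    -- The case of a dominating first row.
    have main : ∀ {e k j k' j' : ℕ} {π : Finset ℕ}, 1 ≤ j → j ≤ k → e + j = (k + 1).choose 2 →
        1 ≤ j' → j' ≤ k' → e + (k' + 1).choose 2 = (n + 1).choose 2 + j' →
        IsMaximizer (n + 1) e π → n ∈ π → IsOneOfSix (n + 1) k j k' j' π := by
      intro e k j k' j' π hj hjk hkj hj' hjk' hkj' h hnπ
      obtain ⟨f, rfl⟩ := Nat.exists_eq_add_of_le' (h.1.2 ▸ single_le_sum (f := fun a => a)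
        (fun a _ => Nat.zero_le a) hnπ : n ≤ e)
      have hmem : π.erase n ∈ Dis n f := Dis.erase_mem h.1 hnπ
      rw [← insert_erase hnπ] at h ⊢
      have hc := choose_two_succ n
      obtain ⟨⟨k₀, j₀⟩, ⟨h1, h2, h3⟩, -⟩ := existsUnique_triangular f
      have hm := h.erase hn hmem
      have hkj'' : f + (k' + 1).choose 2 = n.choose 2 + j' := by omega
      exact isOneOfSix_insert hn h1 h2 h3 hj hjk hkj hj' hjk' hkj'' hm h
        (ih h1 h2 h3 hj' hjk' hkj'' hm)
    by_cases hnπ : n ∈ π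
    · exact main hj hjk hkj hj' hjk' hkj' h hnπ
    · have he := Dis.le_choose h.1
      refine IsOneOfSix.of_sdiff (Dis.subset_Icc h.1) hj hjk
        (triangular_le (by omega) he hjk hkj) hj' hjk'
        (triangular_le (by omega) (Nat.sub_le _ e) hjk' (by omega)) ?_
      exact main hj' hjk' (by omega) hj hjk (by omega) h.sdiff (by simp [hnπ]; omega)

/-! ### Degrees and reduction to threshold graphs -/

open Classical in
/-- The degree of a vertex as a sum of adjacency indicators, which needs no decidability instance
in statements. -/
noncomputable def deg {v : ℕ} (G : SimpleGraph (Fin v)) (i : Fin v) : ℕ :=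
  ∑ j, if G.Adj i j then 1 else 0

open Classical in
lemma deg_eq {v : ℕ} (G : SimpleGraph (Fin v)) (i : Fin v) : G.degree i = deg G i := by
  rw [deg, sum_boole, ← SimpleGraph.card_neighborFinset_eq_degree,
    SimpleGraph.neighborFinset_eq_filter]
  rfl

lemma P2_eq {v : ℕ} (G : SimpleGraph (Fin v)) : P2 G = ∑ i, deg G i ^ 2 := by
  unfold P2
  exact sum_congr rfl fun i _ => by rw [← deg_eq]

lemma sum_deg {v : ℕ} (G : SimpleGraph (Fin v)) : ∑ i, deg G i = 2 * G.edgeSet.ncard := by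
  classical
  rw [← SimpleGraph.coe_edgeFinset, Set.ncard_coe_finset,
    ← SimpleGraph.sum_degrees_eq_twice_card_edges]
  exact sum_congr rfl fun i _ => by rw [← deg_eq]

section Extend

variable {n : ℕ} {G : SimpleGraph (Fin (n + 1))} (u : Fin (n + 1))

lemma deg_of_dominating (h : ∀ i, G.Adj u (u.succAbove i)) :
    deg G u = n ∧ ∀ i, deg G (u.succAbove i) = deg (G.comap u.succAbove) i + 1 := by
  refine ⟨by simp [deg, Fin.sum_univ_succAbove _ u, h], fun i => ?_⟩
  simp [deg, Fin.sum_univ_succAbove _ u, (h i).symm, add_comm]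
  rfl

lemma deg_of_isolated (h : ∀ i, ¬ G.Adj u (u.succAbove i)) :
    deg G u = 0 ∧ ∀ i, deg G (u.succAbove i) = deg (G.comap u.succAbove) i := by
  refine ⟨by simp [deg, Fin.sum_univ_succAbove _ u, h], fun i => ?_⟩
  have : ¬ G.Adj (u.succAbove i) u := fun h' => h i h'.symm
  simp [deg, Fin.sum_univ_succAbove _ u, this]
  rfl

lemma ncard_edgeSet_of_dominating (h : ∀ i, G.Adj u (u.succAbove i)) :
    G.edgeSet.ncard = (G.comap u.succAbove).edgeSet.ncard + n := by
  have h1 := sum_deg G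
  have h2 := sum_deg (G.comap u.succAbove)
  obtain ⟨h3, h4⟩ := deg_of_dominating u h
  rw [Fin.sum_univ_succAbove _ u, h3, sum_congr rfl fun i _ => h4 i, sum_add_distrib] at h1
  simp at h1
  omega

lemma P2_of_dominating (h : ∀ i, G.Adj u (u.succAbove i)) :
    P2 G = P2 (G.comap u.succAbove) + n * (n + 1) + 4 * (G.comap u.succAbove).edgeSet.ncard := by
  have h2 := sum_deg (G.comap u.succAbove)
  obtain ⟨h3, h4⟩ := deg_of_dominating u h
  rw [P2_eq, P2_eq, Fin.sum_univ_succAbove _ u, h3, sum_congr rfl fun i _ => by rw [h4 i]]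
  simp only [add_sq, sum_add_distrib, mul_one, ← mul_sum, h2]
  simp
  ring

lemma ncard_edgeSet_of_isolated (h : ∀ i, ¬ G.Adj u (u.succAbove i)) :
    G.edgeSet.ncard = (G.comap u.succAbove).edgeSet.ncard := by
  have h1 := sum_deg G
  have h2 := sum_deg (G.comap u.succAbove)
  obtain ⟨h3, h4⟩ := deg_of_isolated u h
  rw [Fin.sum_univ_succAbove _ u, h3, sum_congr rfl fun i _ => h4 i, h2] at h1
  omega

lemma P2_of_isolated (h : ∀ i, ¬ G.Adj u (u.succAbove i)) :
    P2 G = P2 (G.comap u.succAbove) := by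
  obtain ⟨h3, h4⟩ := deg_of_isolated u h
  rw [P2_eq, P2_eq, Fin.sum_univ_succAbove _ u, h3, sum_congr rfl fun i _ => by rw [h4 i]]
  simp

end Extend

/-- The graph obtained from `G` by replacing the edge `bc` with `ac`. -/
def switch {v : ℕ} (G : SimpleGraph (Fin v)) (a b c : Fin v) : SimpleGraph (Fin v) :=
  SimpleGraph.fromRel fun x y => (G.Adj x y ∧ s(x, y) ≠ s(b, c)) ∨ s(x, y) = s(a, c)

lemma switch_adj {v : ℕ} {G : SimpleGraph (Fin v)} {a b c x y : Fin v} (hac : a ≠ c) :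
    (switch G a b c).Adj x y ↔ (G.Adj x y ∧ s(x, y) ≠ s(b, c)) ∨ s(x, y) = s(a, c) := by
  simp only [switch, SimpleGraph.fromRel_adj, Sym2.eq_swap (a := y), G.adj_comm y x, or_self,
    and_iff_right_iff_imp]
  rintro (⟨h, -⟩ | h)
  · exact h.ne
  · rintro rfl
    simp at h
    rcases h with h | h
    · exact hac (h.1.symm.trans h.2)
    · exact hac (h.2.symm.trans h.1)

lemma deg_switch {v : ℕ} {G : SimpleGraph (Fin v)} {a b c : Fin v} (hac : a ≠ c)
    (hbc : G.Adj b c) (hnac : ¬ G.Adj a c) (x : Fin v) :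
    (deg (switch G a b c) x : ℤ) =
      deg G x + (if x = a then 1 else 0) - (if x = b then 1 else 0) := by
  classical
  have key : ∀ y, ((if (switch G a b c).Adj x y then 1 else 0 : ℤ)) =
      (if G.Adj x y then 1 else 0) + (if x = a then if y = c then 1 else 0 else 0)
        + (if x = c then if y = a then 1 else 0 else 0)
        - (if x = b then if y = c then 1 else 0 else 0)
        - (if x = c then if y = b then 1 else 0 else 0) := by
    intro y
    have hbc' := hbc.ne
    have hab : a ≠ b := fun h => hnac (h ▸ hbc)
    simp only [switch_adj hac, Sym2.eq_iff, ne_eq]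
    have h1 := hbc.symm
    have h2 : ¬ G.Adj c a := fun h => hnac h.symm
    by_cases hxa : x = a
    · subst hxa
      by_cases hyc : y = c
      · subst hyc; simp_all
      · simp_all
    · by_cases hxb : x = b
      · subst hxb
        by_cases hyc : y = c
        · subst hyc; simp_all
        · simp_all
      · by_cases hxc : x = c
        · subst hxc
          by_cases hya : y = a
          · subst hya; simp_all
          · by_cases hyb : y = b
            · subst hyb; simp_all
            · simp_all
        · simp_all
  simp only [deg]
  push_cast
  rw [sum_congr rfl fun y _ => key y]
  simp only [sum_sub_distrib, sum_add_distrib]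
  split_ifs <;> simp

lemma ncard_edgeSet_switch {v : ℕ} {G : SimpleGraph (Fin v)} {a b c : Fin v} (hac : a ≠ c)
    (hbc : G.Adj b c) (hnac : ¬ G.Adj a c) :
    (switch G a b c).edgeSet.ncard = G.edgeSet.ncard := by
  have h1 := sum_deg (switch G a b c)
  have h2 := sum_deg G
  zify at h1 h2
  rw [sum_congr rfl fun x _ => deg_switch hac hbc hnac x, sum_sub_distrib,
    sum_add_distrib, h2] at h1
  simp at h1
  exact h1.symm

/-- Moving an edge from a vertex to one of at least the same degree increases `P₂`. -/
lemma P2_lt_switch {v : ℕ} {G : SimpleGraph (Fin v)} {a b c : Fin v} (hac : a ≠ c)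
    (hbc : G.Adj b c) (hnac : ¬ G.Adj a c) (hdeg : deg G b ≤ deg G a) :
    P2 G < P2 (switch G a b c) := by
  have hab : a ≠ b := fun h => hnac (h ▸ hbc)
  rw [P2_eq, P2_eq]
  zify at hdeg ⊢
  have key : ∀ x, (deg (switch G a b c) x : ℤ) ^ 2 = (deg G x : ℤ) ^ 2 +
      (if x = a then 2 * (deg G a : ℤ) + 1 else 0) -
        (if x = b then 2 * (deg G b : ℤ) - 1 else 0) := by
    intro x
    rw [deg_switch hac hbc hnac x]
    by_cases hxa : x = a
    · subst hxa; simp [hab]; ring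
    · by_cases hxb : x = b
      · subst hxb; simp [hxa]; ring
      · simp [hxa, hxb]
  rw [sum_congr rfl fun x _ => key x, sum_sub_distrib, sum_add_distrib]
  simp
  omega

/-- In a graph that maximises `P₂` the neighbourhoods are nested along the degrees, by
`P2_lt_switch`; hence a vertex of minimal degree is isolated or one of maximal degree dominates. -/
lemma exists_dominating_or_isolated {n : ℕ} {G : SimpleGraph (Fin (n + 1))}
    (h : ∀ H : SimpleGraph (Fin (n + 1)), H.edgeSet.ncard = G.edgeSet.ncard → P2 H ≤ P2 G) :
    ∃ u, (∀ i, G.Adj u (u.succAbove i)) ∨ ∀ i, ¬ G.Adj u (u.succAbove i) := by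
  have nested : ∀ a b c, deg G b ≤ deg G a → G.Adj b c → a ≠ c → G.Adj a c := by
    intro a b c hd hbc hac
    by_contra hnac
    exact (P2_lt_switch hac hbc hnac hd).not_ge (h _ (ncard_edgeSet_switch hac hbc hnac))
  obtain ⟨u, hu⟩ := Finite.exists_max (deg G)
  obtain ⟨w, hw⟩ := Finite.exists_min (deg G)
  by_cases hiso : ∀ x, ¬ G.Adj w x
  · exact ⟨w, Or.inr fun i => hiso _⟩
  · push Not at hiso
    obtain ⟨x, hx⟩ := hiso
    refine ⟨u, Or.inl fun i => ?_⟩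
    have huw : u = w ∨ G.Adj u w := by
      by_cases h' : u = w
      · exact Or.inl h'
      · exact Or.inr (nested u x w (hu x) hx.symm h')
    have hne : u ≠ u.succAbove i := (Fin.succAbove_ne u i).symm
    rcases huw with rfl | huw
    · -- The minimal and the maximal degree agree, so the neighbourhoods are nested both ways.
      have h1 := nested (u.succAbove i) u
      by_cases hxi : x = u.succAbove i
      · exact hxi ▸ hx
      · exact nested u x _ (hu x) (h1 x (hw _) hx (Ne.symm hxi)).symm hne
    · by_cases hwi : w = u.succAbove i
      · exact hwi ▸ huw
      · exact (nested (u.succAbove i) w u (hw _) huw.symm hne.symm).symm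

/-- The reduction from graphs to partitions: peel off dominating and isolated vertices of a graph that
maximises `P₂`. -/
lemma exists_sqSum_ge {v : ℕ} (G : SimpleGraph (Fin v)) :
    ∃ ρ ∈ Dis v G.edgeSet.ncard, P2 G ≤ sqSum ρ := by
  induction v with
  | zero =>
    refine ⟨∅, ⟨by simp, ?_⟩, by simp [P2]⟩
    have := sum_deg G
    simp at this ⊢
    omega
  | succ n ih =>
    obtain ⟨M, hM, hmax⟩ := Set.exists_max_image
      {H : SimpleGraph (Fin (n + 1)) | H.edgeSet.ncard = G.edgeSet.ncard} P2 (Set.toFinite _)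
      ⟨G, rfl⟩
    refine Exists.imp (fun ρ h => ⟨h.1, (hmax G rfl).trans h.2⟩) (?_ : ∃ ρ, _ ∧ P2 M ≤ sqSum ρ)
    rw [← show M.edgeSet.ncard = _ from hM]
    obtain ⟨u, hu | hu⟩ := exists_dominating_or_isolated (G := M) fun H hH => hmax H (hH.trans hM)
    · obtain ⟨ρ, hρ, hle⟩ := ih (M.comap u.succAbove)
      rcases Nat.eq_zero_or_pos n with rfl | hn
      · refine ⟨ρ, ?_, ?_⟩
        · rw [ncard_edgeSet_of_dominating u hu]
          exact ⟨fun a ha => by have := hρ.1 a ha; omega, hρ.2⟩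
        · rw [P2_of_dominating u hu, ← hρ.2, show ρ = ∅ from
            Finset.eq_empty_of_forall_notMem fun a ha => by have := hρ.1 a ha; omega]
          simp [P2]
      · refine ⟨insert n ρ, ?_, ?_⟩
        · rw [ncard_edgeSet_of_dominating u hu]
          exact Dis.insert_mem hn hρ
        · rw [P2_of_dominating u hu, Dis.sqSum_insert hρ]
          omega
    · obtain ⟨ρ, hρ, hle⟩ := ih (M.comap u.succAbove)
      refine ⟨ρ, ?_, ?_⟩
      · rw [ncard_edgeSet_of_isolated u hu]
        exact ⟨fun a ha => by have := hρ.1 a ha; omega, hρ.2⟩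
      · rwa [P2_of_isolated u hu]

/-! ### Threshold graphs -/

/-- Conjugation: `a_s ≥ i` if and only if more than `s` parts are at least `i`. -/
lemma le_part_iff {π : Finset ℕ} {i s : ℕ} (hi : 0 < i) :
    i ≤ part π s ↔ s < #{x ∈ π | i ≤ x} := by
  induction π using Finset.induction_on_max generalizing s with
  | empty => simp [part]; omega
  | insert n ρ hn ih =>
    have hnρ : n ∉ ρ := fun h => lt_irrefl _ (hn n h)
    have hsort : (insert n ρ).sort (· ≥ ·) = n :: ρ.sort (· ≥ ·) :=
      sort_insert _ (fun b hb => (hn b hb).le) hnρ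
    rw [filter_insert]
    by_cases h : i ≤ n
    · rw [if_pos h, card_insert_of_notMem (by simp [hnρ])]
      cases s with
      | zero => simpa [part, hsort] using h
      | succ s => simpa [part, hsort] using ih (s := s)
    · rw [if_neg h]
      have h0 : ({x ∈ ρ | i ≤ x} : Finset ℕ) = ∅ :=
        filter_eq_empty_iff.2 fun x hx => by have := hn x hx; omega
      rw [h0]
      cases s with
      | zero => simpa [part, hsort] using h
      | succ s => simpa [part, hsort, h0] using ih (s := s)

/-- Adjacency in `Th(π)` in terms of part counts, which turns the six graphs into explicit linear
conditions on the two vertices. -/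
lemma Th_adj {v : ℕ} {π : Finset ℕ} {a b : Fin v} (hab : a < b) :
    (Th v π).Adj a b ↔ (a : ℕ) < #{x ∈ π | (b : ℕ) - a ≤ x} := by
  have hab' : (a : ℕ) < b := hab
  rw [← le_part_iff (by omega), Th, SimpleGraph.fromRel_adj]
  have := hab.ne
  simp only [ne_eq, this, not_false_eq_true, true_and]
  omega

/-- Equality of a pulled back graph can be tested on increasing pairs. -/
lemma comap_eq_of_lt {m v : ℕ} {G : SimpleGraph (Fin v)} {H : SimpleGraph (Fin m)}
    {f : Fin m → Fin v} (h : ∀ a b, a < b → (G.Adj (f a) (f b) ↔ H.Adj a b)) :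
    G.comap f = H := by
  ext a b
  rcases lt_trichotomy a b with hab | rfl | hab
  · exact h a b hab
  · simp
  · rw [SimpleGraph.adj_comm _ a b, H.adj_comm a b]
    exact h b a hab

/-- If `n` is a part, then vertex `0` of `Th(π)` dominates. -/
lemma Th_insert {n e : ℕ} {ρ : Finset ℕ} (h : ρ ∈ Dis n e) :
    (∀ i, (Th (n + 1) (insert n ρ)).Adj 0 (Fin.succAbove 0 i)) ∧
      (Th (n + 1) (insert n ρ)).comap (Fin.succAbove 0) = Th n ρ := by
  have hnρ : n ∉ ρ := fun h' => lt_irrefl _ (Dis.lt h h')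
  have hc : ∀ i ≤ n, #{x ∈ insert n ρ | i ≤ x} = #{x ∈ ρ | i ≤ x} + 1 := fun i hi => by
    rw [filter_insert, if_pos hi, card_insert_of_notMem (by simp [hnρ])]
  constructor
  · intro i
    rw [Th_adj (by simp), hc _ (by simp)]
    simp
  · refine comap_eq_of_lt fun a b hab => ?_
    rw [Th_adj hab, Th_adj (by simpa using hab)]
    simp only [Fin.succAbove_zero, Fin.val_succ, Nat.add_sub_add_right]
    rw [hc _ (by omega)]
    omega

/-- If `n` is not a part, then the last vertex of `Th(π)` is isolated. -/
lemma Th_of_notMem {n e : ℕ} {π : Finset ℕ} (h : π ∈ Dis n e) :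
    (∀ i, ¬ (Th (n + 1) π).Adj (Fin.last n) (Fin.succAbove (Fin.last n) i)) ∧
      (Th (n + 1) π).comap (Fin.succAbove (Fin.last n)) = Th n π := by
  constructor
  · intro i
    rw [SimpleGraph.adj_comm, Th_adj (by simp), not_lt]
    have hsub : ({x ∈ π | n - i ≤ x} : Finset ℕ) ⊆ Ico (n - i) n := fun x hx => by
      simp only [mem_filter] at hx
      have := Dis.lt h hx.1
      simp; omega
    have := card_le_card hsub
    simp at this ⊢
    omega
  · refine comap_eq_of_lt fun a b hab => ?_
    rw [Th_adj hab, Th_adj (by simpa using hab)]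
    simp

lemma Th_spec {v e : ℕ} {π : Finset ℕ} (h : π ∈ Dis v e) :
    (Th v π).edgeSet.ncard = e ∧ P2 (Th v π) = sqSum π := by
  induction v generalizing e π with
  | zero =>
    obtain rfl : π = ∅ :=
      Finset.eq_empty_of_forall_notMem fun a ha => by have := h.1 a ha; omega
    obtain rfl : e = 0 := h.2.symm
    have := sum_deg (Th 0 ∅)
    simp at this
    exact ⟨by simp [this], rfl⟩
  | succ n ih =>
    by_cases hn : n ∈ π
    · obtain ⟨f, rfl⟩ := Nat.exists_eq_add_of_le' (h.2 ▸ single_le_sum (f := fun a => a)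
        (fun a _ => Nat.zero_le a) hn : n ≤ e)
      have hρ := Dis.erase_mem h hn
      obtain ⟨h1, h2⟩ := Th_insert hρ
      obtain ⟨h3, h4⟩ := ih hρ
      rw [← insert_erase hn, ncard_edgeSet_of_dominating 0 h1, P2_of_dominating 0 h1, h2, h3, h4,
        Dis.sqSum_insert hρ]
      exact ⟨rfl, rfl⟩
    · have hρ : π ∈ Dis n e := ⟨fun a ha => by
        have := h.1 a ha
        have : a ≠ n := fun h' => hn (h' ▸ ha)
        omega, h.2⟩
      obtain ⟨h1, h2⟩ := Th_of_notMem hρ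
      rw [ncard_edgeSet_of_isolated _ h1, P2_of_isolated _ h1, h2]
      exact ih hρ

lemma isOptimal_iff {v e : ℕ} {π : Finset ℕ} : IsOptimal v e π ↔ IsMaximizer v e π := by
  constructor
  · rintro ⟨h1, h2, h3⟩
    refine ⟨h1, fun ρ hρ => ?_⟩
    rw [← (Th_spec h1).2, ← (Th_spec hρ).2]
    exact h3 _ (Th_spec hρ).1
  · rintro ⟨h1, h2⟩
    refine ⟨h1, (Th_spec h1).1, fun H hH => ?_⟩
    obtain ⟨ρ, hρ, hle⟩ := exists_sqSum_ge H
    rw [show H.edgeSet.ncard = e from hH] at hρ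
    rw [(Th_spec h1).2]
    exact hle.trans (h2 ρ hρ)

lemma exists_isMaximizer {v e : ℕ} {π : Finset ℕ} (h : π ∈ Dis v e) :
    ∃ ρ, IsMaximizer v e ρ := by
  have hfin : (Dis v e).Finite := (range v).powerset.finite_toSet.subset fun ρ hρ =>
    mem_coe.2 (mem_powerset.2 fun a ha => mem_range.2 (Dis.lt hρ ha))
  obtain ⟨ρ, h1, h2⟩ := Set.exists_max_image _ sqSum hfin ⟨π, h⟩
  exact ⟨ρ, h1, h2⟩

section Shapes

variable {v : ℕ} {a b : Fin v}

lemma Th_pi21_adj {k j : ℕ} (hj : 1 ≤ j) (hjk : j ≤ k) (hab : a < b) :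
    (Th v (pi21 k j)).Adj a b ↔ (b : ℕ) < k ∨ ((b : ℕ) = k ∧ (a : ℕ) < k - j) := by
  have hab' : (a : ℕ) < b := hab
  rw [Th_adj hab,
    show ({x ∈ pi21 k j | (b : ℕ) - a ≤ x} : Finset ℕ) = (Icc ((b : ℕ) - a) k).erase j by
    ext x; simp [pi21]; omega, card_erase_eq_ite, Nat.card_Icc]
  split_ifs with h <;> simp at h <;> omega

lemma Th_pi22_adj {k j : ℕ} (hj : 1 ≤ j) (hk : k + 1 ≤ 2 * k - j - 1) (hab : a < b) :
    (Th v (pi22 k j)).Adj a b ↔ (b : ℕ) < k ∨ ((a : ℕ) = 0 ∧ (b : ℕ) ≤ 2 * k - j - 1) := by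
  have hab' : (a : ℕ) < b := hab
  rw [Th_adj hab]
  by_cases h : (b : ℕ) - a ≤ 2 * k - j - 1
  · rw [show ({x ∈ pi22 k j | (b : ℕ) - a ≤ x} : Finset ℕ) =
      insert (2 * k - j - 1) (Icc ((b : ℕ) - a) (k - 2)) by ext x; simp [pi22]; omega,
      card_insert_of_notMem (by simp; omega), Nat.card_Icc]
    omega
  · rw [show ({x ∈ pi22 k j | (b : ℕ) - a ≤ x} : Finset ℕ) = ∅ by ext x; simp [pi22]; omega,
      card_empty]
    omega

lemma Th_pi23_adj {k : ℕ} (hab : a < b) :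
    (Th v (pi23 k)).Adj a b ↔ (b : ℕ) ≤ k ∧ (a : ℕ) + 2 < k := by
  have hab' : (a : ℕ) < b := hab
  rw [Th_adj hab, show ({x ∈ pi23 k | (b : ℕ) - a ≤ x} : Finset ℕ) = Icc (max 3 ((b : ℕ) - a)) k by
    ext x; simp [pi23]; omega, Nat.card_Icc]
  omega

lemma Th_pi11_adj {k j : ℕ} (hjk : j ≤ k) (hkv : k < v) (hab : a < b) :
    (Th v (pi11 v k j)).Adj a b ↔
      (a : ℕ) + k + 1 < v ∨ ((a : ℕ) + k + 1 = v ∧ (b : ℕ) ≤ a + j) := by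
  have hab' : (a : ℕ) < b := hab
  rw [Th_adj hab, pi11, if_neg hkv.ne]
  by_cases h : (b : ℕ) - a ≤ j
  · rw [show ({x ∈ insert j (Icc (k + 1) (v - 1)) | (b : ℕ) - a ≤ x} : Finset ℕ) =
      insert j (Icc (k + 1) (v - 1)) by ext x; simp; omega,
      card_insert_of_notMem (by simp; omega), Nat.card_Icc]
    omega
  · rw [show ({x ∈ insert j (Icc (k + 1) (v - 1)) | (b : ℕ) - a ≤ x} : Finset ℕ) =
      Icc (max ((b : ℕ) - a) (k + 1)) (v - 1) by ext x; simp; omega, Nat.card_Icc]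
    omega

lemma Th_pi12_adj {k j : ℕ} (hj : 1 ≤ j) (hex : Exists12 v k j) (hab : a < b) :
    (Th v (pi12 v k j)).Adj a b ↔
      (a : ℕ) + (2 * k - j - 1) + 1 < v ∨ ((a : ℕ) + k + 1 ≤ v ∧ (b : ℕ) + 2 ≤ v) := by
  have hab' : (a : ℕ) < b := hab
  unfold Exists12 at hex
  rw [Th_adj hab, show ({x ∈ pi12 v k j | (b : ℕ) - a ≤ x} : Finset ℕ) =
    (Icc (max ((b : ℕ) - a) (k - 1)) (v - 1)).erase (2 * k - j - 1) by ext x; simp [pi12]; omega,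
    card_erase_eq_ite, Nat.card_Icc]
  split_ifs with h <;> simp at h <;> omega

lemma Th_pi13_adj {k : ℕ} (hk : 3 ≤ k) (hkv : k < v) (hab : a < b) :
    (Th v (pi13 v k)).Adj a b ↔ (a : ℕ) + k + 1 < v ∨
      ((a : ℕ) + k + 1 = v ∧ (b : ℕ) ≤ a + 2) ∨ ((a : ℕ) + k = v ∧ (b : ℕ) = a + 1) := by
  have hab' : (a : ℕ) < b := hab
  rw [Th_adj hab]
  rcases (by omega : (b : ℕ) - a = 1 ∨ (b : ℕ) - a = 2 ∨ 3 ≤ (b : ℕ) - a) with h | h | h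
  · rw [h, show ({x ∈ pi13 v k | 1 ≤ x} : Finset ℕ) = insert 1 (insert 2 (Icc (k + 1) (v - 1))) by
      ext x; simp [pi13]; omega, card_insert_of_notMem (by simp; omega),
      card_insert_of_notMem (by simp; omega), Nat.card_Icc]
    omega
  · rw [h, show ({x ∈ pi13 v k | 2 ≤ x} : Finset ℕ) = insert 2 (Icc (k + 1) (v - 1)) by
      ext x; simp [pi13]; omega, card_insert_of_notMem (by simp; omega), Nat.card_Icc]
    omega
  · rw [show ({x ∈ pi13 v k | (b : ℕ) - a ≤ x} : Finset ℕ) =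
      Icc (max ((b : ℕ) - a) (k + 1)) (v - 1) by ext x; simp [pi13]; omega, Nat.card_Icc]
    omega

end Shapes

/-! ### Diagonal sequences -/

/-- If on every antidiagonal the two sets of cells differ by the exchange of at most one cell, then the
diagonal sequences agree. -/
lemma diagSeq_eq_of_exchange {v : ℕ} {π ρ : Finset ℕ} {P Q : ℕ → ℕ → Prop}
    (hP : ∀ a b : Fin v, a < b → ((Th v π).Adj a b ↔ P a b))
    (hQ : ∀ a b : Fin v, a < b → ((Th v ρ).Adj a b ↔ Q a b))
    (hPQ : ∀ a b, a < b → b < v → P a b → ¬ Q a b →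
      (∃ c d, c < d ∧ d < v ∧ c + d = a + b ∧ Q c d ∧ ¬ P c d) ∧
      ∀ c d, d < v → c + d = a + b → c < d → P c d → ¬ Q c d → c = a)
    (hQP : ∀ a b, a < b → b < v → Q a b → ¬ P a b →
      (∃ c d, c < d ∧ d < v ∧ c + d = a + b ∧ P c d ∧ ¬ Q c d) ∧
      ∀ c d, d < v → c + d = a + b → c < d → Q c d → ¬ P c d → c = a) :
    diagSeq v π = diagSeq v ρ := by
  funext t
  unfold diagSeq
  set S := {p : Fin v × Fin v | p.1 < p.2 ∧ (Th v π).Adj p.1 p.2 ∧ p.1.val + p.2.val = t}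
  set T := {p : Fin v × Fin v | p.1 < p.2 ∧ (Th v ρ).Adj p.1 p.2 ∧ p.1.val + p.2.val = t}
  have hST : ∀ a b : Fin v, (a, b) ∈ S \ T ↔
      (a < b ∧ (a : ℕ) + b = t ∧ P a b ∧ ¬ Q a b) := fun a b => by
    by_cases hab : a < b
    · simp only [S, T, Set.mem_sdiff, Set.mem_ofPred_eq, hab, hP _ _ hab, hQ _ _ hab]; tauto
    · simp [S, hab]
  have hTS : ∀ a b : Fin v, (a, b) ∈ T \ S ↔
      (a < b ∧ (a : ℕ) + b = t ∧ Q a b ∧ ¬ P a b) := fun a b => by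
    by_cases hab : a < b
    · simp only [S, T, Set.mem_sdiff, Set.mem_ofPred_eq, hab, hP _ _ hab, hQ _ _ hab]; tauto
    · simp [T, hab]
  have hS1 : (S \ T).ncard ≤ 1 := by
    refine (Set.ncard_le_one).2 ?_
    rintro ⟨a, b⟩ h ⟨c, d⟩ h'
    obtain ⟨h1, h2, h3, h4⟩ := (hST _ _).1 h
    obtain ⟨h1', h2', h3', h4'⟩ := (hST _ _).1 h'
    have := (hPQ a b h1 b.2 h3 h4).2 c d d.2 (by omega) h1' h3' h4'
    exact Prod.ext (Fin.ext this.symm) (Fin.ext (by dsimp only; omega))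
  have hT1 : (T \ S).ncard ≤ 1 := by
    refine (Set.ncard_le_one).2 ?_
    rintro ⟨a, b⟩ h ⟨c, d⟩ h'
    obtain ⟨h1, h2, h3, h4⟩ := (hTS _ _).1 h
    obtain ⟨h1', h2', h3', h4'⟩ := (hTS _ _).1 h'
    have := (hQP a b h1 b.2 h3 h4).2 c d d.2 (by omega) h1' h3' h4'
    exact Prod.ext (Fin.ext this.symm) (Fin.ext (by dsimp only; omega))
  have h01 : 0 < (S \ T).ncard ↔ 0 < (T \ S).ncard := by
    rw [Set.ncard_pos, Set.ncard_pos]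
    constructor
    · rintro ⟨⟨a, b⟩, h⟩
      obtain ⟨h1, h2, h3, h4⟩ := (hST _ _).1 h
      obtain ⟨c, d, h5, h6, h7, h8, h9⟩ := (hPQ a b h1 b.2 h3 h4).1
      exact ⟨(⟨c, by omega⟩, ⟨d, h6⟩), (hTS _ _).2 ⟨h5, by dsimp only; omega, h8, h9⟩⟩
    · rintro ⟨⟨a, b⟩, h⟩
      obtain ⟨h1, h2, h3, h4⟩ := (hTS _ _).1 h
      obtain ⟨c, d, h5, h6, h7, h8, h9⟩ := (hQP a b h1 b.2 h3 h4).1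
      exact ⟨(⟨c, by omega⟩, ⟨d, h6⟩), (hST _ _).2 ⟨h5, by dsimp only; omega, h8, h9⟩⟩
  rw [← Set.ncard_inter_add_ncard_sdiff_eq_ncard S T, ← Set.ncard_inter_add_ncard_sdiff_eq_ncard T S,
    Set.inter_comm S T]
  omega

lemma diagSeq_pi12 {v k j : ℕ} (hj : 1 ≤ j) (hex : Exists12 v k j) :
    diagSeq v (pi12 v k j) = diagSeq v (pi11 v k j) := by
  have hex' := hex
  unfold Exists12 at hex'
  refine diagSeq_eq_of_exchange
    (P := fun a b => a + (2 * k - j - 1) + 1 < v ∨ (a + k + 1 ≤ v ∧ b + 2 ≤ v))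
    (Q := fun a b => a + k + 1 < v ∨ (a + k + 1 = v ∧ b ≤ a + j))
    (fun a b => Th_pi12_adj hj hex)
    (fun a b => Th_pi11_adj (by omega) (by omega)) ?_ ?_
  · intro a b h1 h2 h3 h4
    exact ⟨⟨a + b - (v - 1), v - 1, by omega, by omega, by omega, by omega, by omega⟩,
      fun c d h5 h6 h7 h8 h9 => by omega⟩
  · intro a b h1 h2 h3 h4
    exact ⟨⟨v - 1 - k, a + k, by omega, by omega, by omega, by omega, by omega⟩,
      fun c d h5 h6 h7 h8 h9 => by omega⟩

lemma diagSeq_pi13 {v k j : ℕ} (hjk : j ≤ k) (hkv : k ≤ v ∧ (k = v → j = k))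
    (hex : Exists13 v j) : diagSeq v (pi13 v k) = diagSeq v (pi11 v k j) := by
  obtain ⟨rfl, hv⟩ := hex
  refine diagSeq_eq_of_exchange
    (P := fun a b => a + k + 1 < v ∨ (a + k + 1 = v ∧ b ≤ a + 2) ∨
      (a + k = v ∧ b = a + 1))
    (Q := fun a b => a + k + 1 < v ∨ (a + k + 1 = v ∧ b ≤ a + 3))
    (fun a b => Th_pi13_adj hjk (by omega))
    (fun a b => Th_pi11_adj (by omega) (by omega)) ?_ ?_
  · intro a b h1 h2 h3 h4
    exact ⟨⟨v - 1 - k, v - 1 - k + 3, by omega, by omega, by omega, by omega, by omega⟩,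
      fun c d h5 h6 h7 h8 h9 => by omega⟩
  · intro a b h1 h2 h3 h4
    exact ⟨⟨v - k, v - k + 1, by omega, by omega, by omega, by omega, by omega⟩,
      fun c d h5 h6 h7 h8 h9 => by omega⟩

lemma diagSeq_pi22 {v k j : ℕ} (hj : 1 ≤ j) (hex : Exists22 v k j) :
    diagSeq v (pi22 k j) = diagSeq v (pi21 k j) := by
  unfold Exists22 at hex
  refine diagSeq_eq_of_exchange (P := fun a b => b < k ∨ (a = 0 ∧ b ≤ 2 * k - j - 1))
    (Q := fun a b => b < k ∨ (b = k ∧ a < k - j))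
    (fun a b => Th_pi22_adj hj hex.1)
    (fun a b => Th_pi21_adj hj (by omega)) ?_ ?_
  · intro a b h1 h2 h3 h4
    exact ⟨⟨b - k, k, by omega, by omega, by omega, by omega, by omega⟩,
      fun c d h5 h6 h7 h8 h9 => by omega⟩
  · intro a b h1 h2 h3 h4
    exact ⟨⟨0, a + b, by omega, by omega, by omega, by omega, by omega⟩,
      fun c d h5 h6 h7 h8 h9 => by omega⟩

lemma diagSeq_pi23 {v k j : ℕ} (hjk : j ≤ k) (hkv : k ≤ v ∧ (k = v → j = k))
    (hex : Exists23 v j) : diagSeq v (pi23 k) = diagSeq v (pi21 k j) := by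
  obtain ⟨rfl, hv⟩ := hex
  refine diagSeq_eq_of_exchange (P := fun a b => b ≤ k ∧ a + 2 < k)
    (Q := fun a b => b < k ∨ (b = k ∧ a < k - 3))
    (fun a b => Th_pi23_adj)
    (fun a b => Th_pi21_adj (by omega) hjk) ?_ ?_
  · intro a b h1 h2 h3 h4
    exact ⟨⟨k - 2, k - 1, by omega, by omega, by omega, by omega, by omega⟩,
      fun c d h5 h6 h7 h8 h9 => by omega⟩
  · intro a b h1 h2 h3 h4
    exact ⟨⟨k - 3, k, by omega, by omega, by omega, by omega, by omega⟩,
      fun c d h5 h6 h7 h8 h9 => by omega⟩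

/-! ### Quasi-complete and quasi-star graphs -/

lemma quasiComplete_adj {v e k j : ℕ} (hj : 1 ≤ j) (hjk : j ≤ k) (h : e + j = (k + 1).choose 2)
    {a b : Fin v} (hab : a < b) :
    (quasiComplete v e).Adj a b ↔ (b : ℕ) < k ∨ ((b : ℕ) = k ∧ (a : ℕ) < k - j) := by
  have hab' : (a : ℕ) < b := hab
  rw [quasiComplete, SimpleGraph.fromRel_adj]
  constructor
  · rintro ⟨-, ⟨k', j', h1, h2, h3, h4⟩ | ⟨k', j', h1, h2, h3, h4⟩⟩ <;>
    · obtain ⟨rfl, rfl⟩ := triangular_unique hj hjk h h1 h2 h3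
      omega
  · intro h'
    exact ⟨hab.ne, Or.inl ⟨k, j, hj, hjk, h, by omega⟩⟩

/-- The threshold graph of `pi21 k j` is `QC(v, e)` on the nose, without relabelling. -/
lemma Th_pi21 {v e k j : ℕ} (hj : 1 ≤ j) (hjk : j ≤ k) (h : e + j = (k + 1).choose 2) :
    Th v (pi21 k j) = quasiComplete v e := by
  rw [← SimpleGraph.comap_id (G := Th v (pi21 k j))]
  exact comap_eq_of_lt fun a b hab => by
    rw [quasiComplete_adj hj hjk h hab]; exact Th_pi21_adj hj hjk hab

/-- Reversing the labels of the vertices turns `QS(v, e)` into the threshold graph of `pi11 v k j`. -/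
lemma Th_pi11 {v e k j : ℕ} (hj : 1 ≤ j) (hjk : j ≤ k) (hkv : k ≤ v ∧ (k = v → j = k))
    (h : v.choose 2 - e + j = (k + 1).choose 2) :
    (quasiStar v e).comap Fin.rev = Th v (pi11 v k j) := by
  refine comap_eq_of_lt fun a b hab => ?_
  have hab' : (a : ℕ) < b := hab
  have hb := b.2
  rw [quasiStar, SimpleGraph.compl_adj, SimpleGraph.adj_comm,
    quasiComplete_adj hj hjk h (Fin.rev_lt_rev.2 hab), Fin.val_rev, Fin.val_rev]
  simp only [ne_eq, Fin.rev_inj, hab.ne, not_false_eq_true, true_and]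
  rcases hkv.1.eq_or_lt with rfl | hlt
  · simp only [Th_adj hab, pi11, if_true, filter_empty, card_empty]
    omega
  · rw [Th_pi11_adj hjk hlt hab]
    omega

lemma P2_congr {v : ℕ} {G H : SimpleGraph (Fin v)} (f : G ≃g H) : P2 G = P2 H := by
  classical
  unfold P2
  rw [← Equiv.sum_comp f.toEquiv fun i => H.degree i ^ 2]
  exact sum_congr rfl fun i _ => by
    congr 1
    convert (f.degree_eq i).symm
    rfl

lemma pi11_mem_Dis {n e k j : ℕ} (he : e ≤ (n + 1).choose 2) (hj : 1 ≤ j) (hjk : j ≤ k)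
    (h : (n + 1).choose 2 - e + j = (k + 1).choose 2) : pi11 (n + 1) k j ∈ Dis (n + 1) e := by
  have hk := triangular_le n.succ_pos (Nat.sub_le _ _) hjk h
  rw [← sdiff_pi21 hj hjk hk.1 hk.2]
  have := Dis.sdiff_mem (pi21_mem_Dis n.succ_pos (Nat.sub_le _ _) hj hjk h)
  rwa [Nat.sub_sub_self he] at this

lemma sqSum_sdiff_congr {n e : ℕ} {π ρ : Finset ℕ} (hπ : π ∈ Dis (n + 1) e)
    (hρ : ρ ∈ Dis (n + 1) e) (h : sqSum π = sqSum ρ) :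
    sqSum (Icc 1 n \ π) = sqSum (Icc 1 n \ ρ) := by
  have h1 := sqSum_compl (Dis.subset_Icc hπ)
  have h2 := sqSum_compl (Dis.subset_Icc hρ)
  rw [hπ.2] at h1
  rw [hρ.2] at h2
  omega

theorem theorem2p2 (v e : ℕ) (hv : 0 < v) (he : e ≤ v.choose 2) :
    (∃! p : ℕ × ℕ, 1 ≤ p.2 ∧ p.2 ≤ p.1 ∧ e + p.2 = (p.1 + 1).choose 2) ∧
    (∃! p : ℕ × ℕ, 1 ≤ p.2 ∧ p.2 ≤ p.1 ∧ e + (p.1 + 1).choose 2 = v.choose 2 + p.2) ∧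
    ∀ k j k' j' : ℕ,
      1 ≤ j → j ≤ k → e + j = (k + 1).choose 2 →
      1 ≤ j' → j' ≤ k' → e + (k' + 1).choose 2 = v.choose 2 + j' →
      -- every optimal partition is one of the six
      (∀ π : Finset ℕ, IsOptimal v e π →
        π = pi11 v k' j' ∨
        (Exists12 v k' j' ∧ π = pi12 v k' j') ∨
        (Exists13 v j' ∧ π = pi13 v k') ∨
        π = pi21 k j ∨
        (Exists22 v k j ∧ π = pi22 k j) ∨
        (Exists23 v j ∧ π = pi23 k)) ∧
      -- existence of the six partitions
      IsQuasiStarPartition v e (pi11 v k' j') ∧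
      (Exists12 v k' j' → pi12 v k' j' ∈ Dis v e) ∧
      (Exists13 v j' → pi13 v k' ∈ Dis v e) ∧
      IsQuasiCompletePartition v e (pi21 k j) ∧
      (Exists22 v k j → pi22 k j ∈ Dis v e) ∧
      (Exists23 v j → pi23 k ∈ Dis v e) ∧
      -- one of the two main partitions is optimal
      (IsOptimal v e (pi11 v k' j') ∨ IsOptimal v e (pi21 k j)) ∧
      -- equal diagonal sequences
      (Exists12 v k' j' → diagSeq v (pi12 v k' j') = diagSeq v (pi11 v k' j')) ∧
      (Exists13 v j' → diagSeq v (pi13 v k') = diagSeq v (pi11 v k' j')) ∧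
      (Exists22 v k j → diagSeq v (pi22 k j) = diagSeq v (pi21 k j)) ∧
      (Exists23 v j → diagSeq v (pi23 k) = diagSeq v (pi21 k j)) ∧
      -- optimality
      (qcSum v e ≤ qsSum v e →
        IsOptimal v e (pi11 v k' j') ∧
        (Exists12 v k' j' → IsOptimal v e (pi12 v k' j')) ∧
        (Exists13 v j' → IsOptimal v e (pi13 v k'))) ∧
      (qsSum v e ≤ qcSum v e →
        IsOptimal v e (pi21 k j) ∧
        (Exists22 v k j → IsOptimal v e (pi22 k j)) ∧
        (Exists23 v j → IsOptimal v e (pi23 k))) := by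
  refine ⟨existsUnique_triangular e, ?_, ?_⟩
  · have hiff : ∀ p : ℕ × ℕ, (1 ≤ p.2 ∧ p.2 ≤ p.1 ∧ e + (p.1 + 1).choose 2 = v.choose 2 + p.2) ↔
        (1 ≤ p.2 ∧ p.2 ≤ p.1 ∧ v.choose 2 - e + p.2 = (p.1 + 1).choose 2) := fun p => by omega
    simp only [hiff]
    exact existsUnique_triangular _
  intro k j k' j' hj hjk h hj' hjk' h'
  obtain ⟨n, rfl⟩ : ∃ n, v = n + 1 := ⟨v - 1, by omega⟩
  have hc : (n + 1).choose 2 - e + j' = (k' + 1).choose 2 := by omega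
  have hle := Nat.sub_le ((n + 1).choose 2) e
  have hk := triangular_le hv he hjk h
  have hk' := triangular_le hv hle hjk' hc
  have m11 := pi11_mem_Dis he hj' hjk' hc
  have m21 := pi21_mem_Dis hv he hj hjk h
  have m22 : Exists22 (n + 1) k j → _ := pi22_mem_Dis hj h
  have m23 : Exists23 (n + 1) j → _ := pi23_mem_Dis he hjk h
  have s22 : Exists22 (n + 1) k j → sqSum (pi22 k j) = sqSum (pi21 k j) := fun hex => by
    unfold Exists22 at hex
    exact sqSum_pi22 (by omega) hj
  have s23 : Exists23 (n + 1) j → sqSum (pi23 k) = sqSum (pi21 k j) := by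
    rintro ⟨rfl, -⟩
    exact sqSum_pi23 hjk
  -- The facts about `pi12` and `pi13` are those about `pi22` and `pi23` for the complementary number
  -- of edges.
  have c11 := sdiff_pi21 hj' hjk' hk'.1 hk'.2
  have c21 := pi21_mem_Dis hv hle hj' hjk' hc
  have c12 : Exists12 (n + 1) k' j' → pi12 (n + 1) k' j' ∈ Dis (n + 1) e ∧
      sqSum (pi12 (n + 1) k' j') = sqSum (pi11 (n + 1) k' j') := fun hex => by
    have h1 := pi22_mem_Dis hj' hc hex
    rw [← c11, ← sdiff_pi22 hj' hex]
    have := Dis.sdiff_mem h1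
    rw [Nat.sub_sub_self he] at this
    unfold Exists12 at hex
    exact ⟨this, sqSum_sdiff_congr h1 c21 (sqSum_pi22 (by omega) hj')⟩
  have c13 : Exists13 (n + 1) j' → pi13 (n + 1) k' ∈ Dis (n + 1) e ∧
      sqSum (pi13 (n + 1) k') = sqSum (pi11 (n + 1) k' j') := fun hex => by
    have h1 := pi23_mem_Dis hle hjk' hc hex
    obtain ⟨rfl, hn⟩ := hex
    rw [← c11, ← sdiff_pi23 hjk' (by omega)]
    have := Dis.sdiff_mem h1
    rw [Nat.sub_sub_self he] at this
    exact ⟨this, sqSum_sdiff_congr h1 c21 (sqSum_pi23 hjk')⟩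
  have i11 : Th (n + 1) (pi11 (n + 1) k' j') ≃g quasiStar (n + 1) e :=
    ⟨Fin.revPerm, by intro a b; rw [← Th_pi11 hj' hjk' hk' hc]; rfl⟩
  have hqs : qsSum (n + 1) e = sqSum (pi11 (n + 1) k' j') := by
    rw [qsSum, ← P2_congr i11, (Th_spec m11).2]
  have hqc : qcSum (n + 1) e = sqSum (pi21 k j) := by
    rw [qcSum, ← Th_pi21 hj hjk h, (Th_spec m21).2]
  have six : ∀ π, IsMaximizer (n + 1) e π → IsOneOfSix (n + 1) k j k' j' π := fun π hπ =>
    hπ.isOneOfSix hv hj hjk h hj' hjk' h'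
  have main : IsMaximizer (n + 1) e (pi11 (n + 1) k' j') ∨ IsMaximizer (n + 1) e (pi21 k j) := by
    obtain ⟨π, hπ⟩ := exists_isMaximizer m11
    rcases six π hπ with rfl | ⟨hex, rfl⟩ | ⟨hex, rfl⟩ | rfl | ⟨hex, rfl⟩ | ⟨hex, rfl⟩
    · exact Or.inl hπ
    · exact Or.inl (hπ.congr m11 (c12 hex).2.symm)
    · exact Or.inl (hπ.congr m11 (c13 hex).2.symm)
    · exact Or.inr hπ
    · exact Or.inr (hπ.congr m21 (s22 hex).symm)
    · exact Or.inr (hπ.congr m21 (s23 hex).symm)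
  simp only [isOptimal_iff]
  refine ⟨six, ⟨m11, ⟨i11⟩⟩, fun hex => (c12 hex).1, fun hex => (c13 hex).1,
    ⟨m21, ⟨Th_pi21 hj hjk h ▸ SimpleGraph.Iso.refl⟩⟩, m22, m23, main, diagSeq_pi12 hj',
    diagSeq_pi13 hjk' hk', diagSeq_pi22 hj, diagSeq_pi23 hjk hk, fun hS => ?_, fun hS => ?_⟩
  · rw [hqs, hqc] at hS
    have hopt : IsMaximizer (n + 1) e (pi11 (n + 1) k' j') := main.elim id fun hM =>
      hM.congr m11 (le_antisymm (hM.2 _ m11) hS)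
    exact ⟨hopt, fun hex => hopt.congr (c12 hex).1 (c12 hex).2,
      fun hex => hopt.congr (c13 hex).1 (c13 hex).2⟩
  · rw [hqs, hqc] at hS
    have hopt : IsMaximizer (n + 1) e (pi21 k j) := main.elim (fun hM =>
      hM.congr m21 (le_antisymm (hM.2 _ m21) hS)) id
    exact ⟨hopt, fun hex => hopt.congr (m22 hex) (s22 hex),
      fun hex => hopt.congr (m23 hex) (s23 hex)⟩
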